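/- For $\Im z>0$ let $q=\exp(2\pi i z)$ and $\eta_n=q^{n/24}\prod_{k>0}(1-q^{nk})$, and let $q\frac{\mathrm d}{\mathrm dq}=\frac1{2\pi i}\frac{\mathrm d}{\mathrm dz}$. Let $$H(x)=\frac{(x^2-1)^2}{9(x^2+3)}\sum_{n=0}^\infty\frac{(4/3)_n(5/3)_n}{n!\,(n+1)!}\left(\frac{x^2(x^2-9)^2}{(x^2+3)^3}\right)^{n+1},\qquad (a)_n=\frac{\Gamma(a+n)}{\Gamma(a)},$$ which is the hypergeometric solution, given by Ablinger et al., of the homogeneous part of a second-order differential equation at three loops. Put $$x=x(z)=3\,\frac{\eta_1^2\eta_6^4}{\eta_2^4\eta_3^2},\qquad f_2=\frac{\eta_2^6\eta_3}{\eta_1^3\eta_6^2}.$$ Let $R$ be the set of all $z$ with $\Im z>0$, $x(z)^2+3\neq0$ and $\left|\frac{x^2(x^2-9)^2}{(x^2+3)^3}\right|<1$. Then $R$ contains a half-plane $\Im z>C$ (a neighbourhood of $q=0$). For every $z$ in the connected component of $R$ that contains this half-plane, the series for $H(x(z))$ converges absolutely, $f_2$ is complex differentiable at $z$, and $$H\!\left(3\,\frac{\eta_1^2\eta_6^4}{\eta_2^4\eta_3^2}\right)=\frac12\left(\frac{\eta_1^{14}\eta_6^{10}}{\eta_2^{22}\eta_3^2}\,f_2+\frac{\eta_1^6\eta_6^4}{\eta_2^{12}\eta_3^2}\left(\frac{\eta_1^4\eta_6^8}{\eta_2^8\eta_3^4}+\frac13\right)q\frac{\mathrm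 df_2}{\mathrm dq}\right).$$ -/

import Mathlib

/-!
Eta quotients of level 6 as functions of `z` in the upper half-plane, with nome
`q = exp (2 π i z)`, and the hypergeometric function `H`.
-/

noncomputable section

namespace EtaSunrise

/-- `η_n = q^(n/24) ∏_{k>0} (1 - q^(n k))` with `q = exp (2 π i z)`, that is, the Dedekind
eta function at `n z`. -/
def etaN (n : ℕ) (z : ℂ) : ℂ := ModularForm.eta ((n : ℂ) * z)

/-- The operator `q d/dq = (2 π i)⁻¹ d/dz`, for functions of `q = exp (2 π i z)` that are
written as functions of `z`. -/
def qDeriv (f : ℂ → ℂ) (z : ℂ) : ℂ :=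
  (2 * (Real.pi : ℂ) * Complex.I)⁻¹ * deriv f z

/-- The Pochhammer symbol `(a)_n = Γ(a + n) / Γ(a)`. -/
def pochhammerSymbol (a : ℂ) (n : ℕ) : ℂ :=
  Complex.Gamma (a + n) / Complex.Gamma a

/-- The argument `x² (x² - 9)² / (x² + 3)³` of the hypergeometric series. -/
def hyperArg (x : ℂ) : ℂ := x ^ 2 * (x ^ 2 - 9) ^ 2 / (x ^ 2 + 3) ^ 3

/-- The `n`-th term of the hypergeometric series, in the variable `x`. -/
def hyperTerm (x : ℂ) (n : ℕ) : ℂ :=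
  pochhammerSymbol (4 / 3) n * pochhammerSymbol (5 / 3) n /
    ((n.factorial : ℂ) * ((n + 1).factorial : ℂ)) * hyperArg x ^ (n + 1)

/-- The function `H(x)`. -/
def H (x : ℂ) : ℂ := (x ^ 2 - 1) ^ 2 / (9 * (x ^ 2 + 3)) * ∑' n : ℕ, hyperTerm x n

/-- The parametrization `x = 3 η₁² η₆⁴ / (η₂⁴ η₃²)`. -/
def xPar (z : ℂ) : ℂ :=
  3 * (etaN 1 z ^ 2 * etaN 6 z ^ 4 / (etaN 2 z ^ 4 * etaN 3 z ^ 2))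

/-- The eta quotient `f₂ = η₂⁶ η₃ / (η₁³ η₆²)`. -/
def f₂ (z : ℂ) : ℂ := etaN 2 z ^ 6 * etaN 3 z / (etaN 1 z ^ 3 * etaN 6 z ^ 2)

/-- The points `z` of the upper half-plane at which `H (xPar z)` is given by its series:
`x² + 3 ≠ 0` and the argument of the series is less than `1` in absolute value. -/
def convergenceRegion : Set ℂ :=
  {z | 0 < z.im ∧ xPar z ^ 2 + 3 ≠ 0 ∧ ‖hyperArg (xPar z)‖ < 1}

/-- The connected component of the convergence region that contains a neighbourhood of `q = 0`,
that is, a half-plane `Im z > C`. -/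
def cuspComponent : Set ℂ :=
  {z | ∃ S : Set ℂ, S ⊆ convergenceRegion ∧ IsPreconnected S ∧ z ∈ S ∧
    ∃ C : ℝ, {w : ℂ | C < w.im} ⊆ S}

end EtaSunrise

end

/-!
The identity is the derivative of a modular parametrization of `₂F₁(1/3, 2/3; 1; w)`. Write `Q` for
the nome and `θ = Q d/dQ`, and put `u = x² / 9`, `f = f₂`, `a = f (1 + 3 u)`. The argument of the
hypergeometric series is `w = 27 u (1 - u)² / (1 + 3 u)³`, with `1 - w = (1 - 9 u)² / (1 + 3 u)³`.
Two facts are needed: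

* `θ u = u · η₁⁴ η₃⁴ / (η₂² η₆²)`, and this eta quotient equals `(1 - u) (1 - 9 u) f²`. It follows
  that `θ w = w (1 - w) a²`;
* `θ (θ a / a²) = (2/9) w (1 - w) a³`, which says that `a` satisfies the hypergeometric equation
  `d/dw (w (1 - w) dy/dw) = (2/9) y`.

Both `a` and `₂F₁(1/3, 2/3; 1; w)` are holomorphic with value `1` at the cusp `Q = 0`, so that their
Wronskian vanishes and they agree near the cusp (`exists_radius_hyperSum`). The series in `H` is
`(9/2) w d/dw` of `₂F₁(1/3, 2/3; 1; w)`, hence `H = θ a / (6 f²)` near the cusp, and this is the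
asserted combination of `f` and `θ f`. Both sides are holomorphic on the convergence region, and
the identity theorem carries the equality along the connected component of the cusp.

The two facts are proved without the theory of modular forms of higher level. On the torus with
periods `1` and `6 τ`, consider the Lambert series of the zeta function at the points `s τ`,
`1 ≤ s ≤ 5`; these are the series `lam Q 0 s`, which converge absolutely as sums over `ℤ`. The
subtraction formula of the hyperbolic cotangent (`kern_addition`), summed over pairs of integers,
gives the addition formula of the zeta function and, with polynomial weights, its derivatives
(`lam_addition`, `lam_addition_deriv`, `lam_addition_deriv_deriv`). At the points `τ`, `2 τ`, `3 τ`
these relations say that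

* the products of the weight one forms `fSer = 1 + 3 lam Q 0 1` and `bSer = 1 + 6 lam Q 0 2` are
  explicit combinations of the series `∑ σ(n) Q^(d n)`, `d ∣ 6` (`fSer_bSer_quadratic`);
* `fSer`, `bSer` and the quasimodular form `mSer` satisfy a closed system of differential equations
  (`hasDerivAt_fSer`, `hasDerivAt_bSer`, `hasDerivAt_mSer`).

Since the series `∑ σ(n) Q^(d n)` are the logarithmic derivatives of the Euler products, the first
relations identify `fSer`, `(fSer - bSer) / 3 = u f` and `(1 - u) (1 - 9 u) f²` with eta quotients
by comparing logarithmic derivatives, and the second ones turn both facts into polynomial identities.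
-/

noncomputable section

namespace EtaSunrise

/-! ### Lambert series over the integers -/

/-- The kernel `1 / (1 - Q^(6 n))`. Its value at `n = 0` is `1 / 0 = 0`, so that the sums over `ℤ`
below automatically leave out `n = 0`. -/
def kern (Q : ℂ) (n : ℤ) : ℂ := 1 / (1 - Q ^ (6 * n))

/-- The `n`-th term of the Lambert series `∑ n^j Q^(s n) / (1 - Q^(6 n))` over `ℤ`. -/
def lamTerm (Q : ℂ) (j : ℕ) (s : ℤ) (n : ℤ) : ℂ := (n : ℂ) ^ j * kern Q n * Q ^ (s * n)

/-- The `n`-th term of the series `-∑ n^j Q^(6 n) Q^(s n) / (1 - Q^(6 n))²` over `ℤ`, which arises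
when the denominators of a Lambert series are differentiated. -/
def dlamTerm (Q : ℂ) (j : ℕ) (s : ℤ) (n : ℤ) : ℂ :=
  (n : ℂ) ^ j * (kern Q n * (1 - kern Q n)) * Q ^ (s * n)

/-- The Lambert series `∑ n^j Q^(s n) / (1 - Q^(6 n))` over nonzero integers `n`. -/
def lam (Q : ℂ) (j : ℕ) (s : ℤ) : ℂ := ∑' n : ℤ, lamTerm Q j s n

/-- The series `-∑ n^j Q^(6 n) Q^(s n) / (1 - Q^(6 n))²` over nonzero integers `n`. -/
def dlam (Q : ℂ) (j : ℕ) (s : ℤ) : ℂ := ∑' n : ℤ, dlamTerm Q j s n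

variable {Q : ℂ}

lemma one_sub_pow_ne_zero (hQ : ‖Q‖ < 1) {n : ℕ} (hn : n ≠ 0) : 1 - Q ^ n ≠ 0 := by
  intro h
  have h1 : ‖Q ^ n‖ < 1 := by
    rw [norm_pow]; exact pow_lt_one₀ (norm_nonneg _) hQ hn
  rw [← sub_eq_zero.1 h] at h1
  simp at h1

lemma one_sub_zpow_ne_zero (hQ : ‖Q‖ < 1) {n : ℤ} (hn : n ≠ 0) :
    1 - Q ^ (6 * n) ≠ 0 := by
  intro h
  rcases lt_trichotomy n 0 with h1 | h1 | h1
  · obtain ⟨k, rfl⟩ : ∃ k : ℕ, n = -k := ⟨n.natAbs, by omega⟩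
    have hk : 6 * k ≠ 0 := by omega
    apply one_sub_pow_ne_zero hQ hk
    have : Q ^ (6 * k) = (Q ^ (6 * (-(k : ℤ))))⁻¹ := by
      rw [← zpow_neg, ← zpow_natCast]; push_cast; ring_nf
    rw [this, ← sub_eq_zero.1 h]; simp
  · exact hn h1
  · obtain ⟨k, rfl⟩ : ∃ k : ℕ, n = k := ⟨n.natAbs, by omega⟩
    have hk : 6 * k ≠ 0 := by omega
    exact one_sub_pow_ne_zero hQ hk (by exact_mod_cast h)

@[simp] lemma kern_zero : kern Q 0 = 0 := by simp [kern]

lemma kern_neg (hQ : ‖Q‖ < 1) (h0 : Q ≠ 0) {n : ℤ} (hn : n ≠ 0) :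
    kern Q (-n) = 1 - kern Q n := by
  have h := one_sub_zpow_ne_zero hQ hn
  have h2 := one_sub_zpow_ne_zero hQ (neg_ne_zero.2 hn)
  have h3 : Q ^ (6 * -n) = (Q ^ (6 * n))⁻¹ := by rw [← zpow_neg]; ring_nf
  have h4 : Q ^ (6 * n) ≠ 0 := zpow_ne_zero _ h0
  unfold kern
  rw [h3] at h2 ⊢
  generalize Q ^ (6 * n) = X at *
  have h5 : X - 1 ≠ 0 := by intro h'; apply h; linear_combination -h'
  have h6 : 1 - X⁻¹ = (X - 1) / X := by field_simp
  rw [h6]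
  field_simp
  ring

lemma norm_kern_natCast_le (hQ : ‖Q‖ < 1) (n : ℕ) : ‖kern Q n‖ ≤ 1 / (1 - ‖Q‖) := by
  rcases Nat.eq_zero_or_pos n with rfl | hn
  · simp [sub_nonneg.2 hQ.le]
  · rw [kern, norm_div, norm_one]
    have h : 1 - ‖Q‖ ≤ ‖1 - Q ^ (6 * (n : ℤ))‖ := by
      have h1 : ‖Q ^ (6 * (n : ℤ))‖ ≤ ‖Q‖ := by
        have : Q ^ (6 * (n : ℤ)) = Q ^ (6 * n) := by exact_mod_cast zpow_natCast Q (6 * n)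
        rw [this, norm_pow]
        exact pow_le_of_le_one (norm_nonneg _) hQ.le (by omega)
      have h2 := norm_sub_norm_le (1 : ℂ) (Q ^ (6 * (n : ℤ)))
      rw [norm_one] at h2
      linarith
    have h3 : 0 < 1 - ‖Q‖ := by linarith
    gcongr

lemma kern_neg_natCast (hQ : ‖Q‖ < 1) (h0 : Q ≠ 0) (n : ℕ) :
    kern Q (-n) = -(Q ^ (6 * n) * kern Q n) := by
  rcases Nat.eq_zero_or_pos n with rfl | hn
  · simp
  · rw [kern_neg hQ h0 (by omega)]
    have h : 1 - Q ^ (6 * n) ≠ 0 := one_sub_pow_ne_zero hQ (by omega)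
    have : Q ^ (6 * (n : ℤ)) = Q ^ (6 * n) := by exact_mod_cast zpow_natCast Q (6 * n)
    rw [kern, this]
    field_simp
    ring

lemma norm_kern_le (hQ : ‖Q‖ < 1) (h0 : Q ≠ 0) (n : ℤ) : ‖kern Q n‖ ≤ 1 / (1 - ‖Q‖) := by
  obtain ⟨k, rfl | rfl⟩ := Int.eq_nat_or_neg n
  · exact norm_kern_natCast_le hQ k
  · rw [kern_neg_natCast hQ h0, norm_neg, norm_mul, norm_pow]
    exact (mul_le_of_le_one_left (norm_nonneg _) (pow_le_one₀ (norm_nonneg _) hQ.le)).trans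
      (norm_kern_natCast_le hQ k)

lemma norm_lamTerm_le (hQ : ‖Q‖ < 1) (h0 : Q ≠ 0) (j : ℕ) {s : ℤ} (hs : 1 ≤ s) (hs' : s ≤ 5)
    (n : ℤ) : ‖lamTerm Q j s n‖ ≤
      1 / (1 - ‖Q‖) * ‖((n.natAbs : ℂ)) ^ j * Q ^ n.natAbs‖ := by
  obtain ⟨k, rfl | rfl⟩ := Int.eq_nat_or_neg n
  · obtain ⟨t, rfl⟩ : ∃ t : ℕ, s = t := ⟨s.natAbs, by omega⟩
    have h1 : Q ^ ((t : ℤ) * (k : ℤ)) = Q ^ (t * k) := by exact_mod_cast zpow_natCast Q (t * k)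
    rw [lamTerm, h1]
    simp only [norm_mul, norm_pow, Int.natAbs_natCast, Int.cast_natCast]
    have h2 : ‖Q‖ ^ (t * k) ≤ ‖Q‖ ^ k :=
      pow_le_pow_of_le_one (norm_nonneg _) hQ.le (by nlinarith)
    calc _ ≤ ‖(k : ℂ)‖ ^ j * (1 / (1 - ‖Q‖)) * ‖Q‖ ^ k := by
          gcongr
          exact norm_kern_natCast_le hQ k
      _ = _ := by ring
  · obtain ⟨t, rfl⟩ : ∃ t : ℕ, s = 6 - (t : ℤ) := ⟨(6 - s).natAbs, by omega⟩
    have h1 : Q ^ (6 * k) * Q ^ ((6 - (t : ℤ)) * -(k : ℤ)) = Q ^ (t * k) := by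
      rw [← zpow_natCast, ← zpow_natCast, ← zpow_add₀ h0]; push_cast; ring_nf
    rw [lamTerm, kern_neg_natCast hQ h0]
    have h3 : ((-(k : ℤ) : ℤ) : ℂ) ^ j * -(Q ^ (6 * k) * kern Q k) *
        Q ^ ((6 - (t : ℤ)) * -(k : ℤ)) = -(((-(k : ℤ) : ℤ) : ℂ) ^ j * kern Q k * Q ^ (t * k)) := by
      rw [← h1]; ring
    rw [h3]
    simp only [norm_neg, norm_mul, norm_pow, Int.natAbs_natCast, Int.cast_natCast, Int.cast_neg,
      Int.natAbs_neg]
    have h2 : ‖Q‖ ^ (t * k) ≤ ‖Q‖ ^ k :=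
      pow_le_pow_of_le_one (norm_nonneg _) hQ.le (by nlinarith [show 1 ≤ t by omega])
    calc _ ≤ ‖(k : ℂ)‖ ^ j * (1 / (1 - ‖Q‖)) * ‖Q‖ ^ k := by
          gcongr
          exact norm_kern_natCast_le hQ k
      _ = _ := by ring

lemma summable_natAbs_pow_mul (hQ : ‖Q‖ < 1) (j : ℕ) :
    Summable fun n : ℤ => ‖((n.natAbs : ℂ)) ^ j * Q ^ n.natAbs‖ := by
  have h := summable_norm_pow_mul_geometric_of_norm_lt_one j hQ
  refine Summable.of_nat_of_neg ?_ ?_ <;> simpa using! h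

lemma summable_norm_lamTerm (hQ : ‖Q‖ < 1) (h0 : Q ≠ 0) (j : ℕ) {s : ℤ} (hs : 1 ≤ s)
    (hs' : s ≤ 5) : Summable fun n => ‖lamTerm Q j s n‖ :=
  .of_nonneg_of_le (fun _ => norm_nonneg _) (norm_lamTerm_le hQ h0 j hs hs')
    ((summable_natAbs_pow_mul hQ j).mul_left _)

lemma summable_dlamTerm (hQ : ‖Q‖ < 1) (h0 : Q ≠ 0) (j : ℕ) {s : ℤ} (hs : 1 ≤ s)
    (hs' : s ≤ 5) : Summable (dlamTerm Q j s) := by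
  refine .of_norm_bounded
    ((summable_norm_lamTerm hQ h0 j hs hs').mul_left (1 / (1 - ‖Q‖))) fun n => ?_
  rcases eq_or_ne n 0 with rfl | hn
  · simp [dlamTerm, lamTerm]
  · have : dlamTerm Q j s n = kern Q (-n) * lamTerm Q j s n := by
      rw [kern_neg hQ h0 hn, dlamTerm, lamTerm]; ring
    rw [this, norm_mul]
    gcongr
    exact norm_kern_le hQ h0 _

lemma hasSum_lam (hQ : ‖Q‖ < 1) (h0 : Q ≠ 0) (j : ℕ) {s : ℤ} (hs : 1 ≤ s) (hs' : s ≤ 5) :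
    HasSum (lamTerm Q j s) (lam Q j s) :=
  (summable_norm_lamTerm hQ h0 j hs hs').of_norm.hasSum

lemma hasSum_dlam (hQ : ‖Q‖ < 1) (h0 : Q ≠ 0) (j : ℕ) {s : ℤ} (hs : 1 ≤ s) (hs' : s ≤ 5) :
    HasSum (dlamTerm Q j s) (dlam Q j s) :=
  (summable_dlamTerm hQ h0 j hs hs').hasSum

/-- The reflection `n ↦ -n` exchanges the exponents `s` and `6 - s`. -/
lemma lam_reflect (hQ : ‖Q‖ < 1) (h0 : Q ≠ 0) (j : ℕ) (s : ℤ) :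
    lam Q j (6 - s) = -(-1) ^ j * lam Q j s := by
  rw [lam, lam, ← tsum_mul_left, ← (Equiv.neg ℤ).tsum_eq]
  refine tsum_congr fun n => ?_
  rw [Equiv.neg_apply]
  rcases eq_or_ne n 0 with rfl | hn
  · simp [lamTerm]
  · have h := one_sub_zpow_ne_zero hQ hn
    have h3 : Q ^ ((6 - s) * -n) * Q ^ (6 * n) = Q ^ (s * n) := by
      rw [← zpow_add₀ h0]; ring_nf
    have h4 : 1 - kern Q n = -(Q ^ (6 * n) * kern Q n) := by
      rw [kern]; field_simp; ring
    rw [lamTerm, lamTerm, kern_neg hQ h0 hn, h4, ← h3]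
    push_cast
    rw [neg_pow (n : ℂ)]
    ring

/-! ### Addition formulas -/

/-- The subtraction formula of the hyperbolic cotangent, written for `1 / (1 - Q^(6 n))`. On the
three lines `a = b`, `a = 0`, `b = 0` correction terms arise. -/
lemma kern_addition (hQ : ‖Q‖ < 1) (h0 : Q ≠ 0) (a b : ℤ) :
    kern Q a * kern Q b - kern Q b * kern Q (a - b) - kern Q a * kern Q (b - a) =
      (if a = b then kern Q a - kern Q a * (1 - kern Q a) else 0) -
      (if a = 0 then kern Q b * (1 - kern Q b) else 0) -
      (if b = 0 then kern Q a * (1 - kern Q a) else 0) := by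
  rcases eq_or_ne a 0 with rfl | ha
  · rcases eq_or_ne b 0 with rfl | hb
    · simp
    · simp [hb, hb.symm, kern_neg hQ h0 hb]
  · rcases eq_or_ne b 0 with rfl | hb
    · simp [ha, kern_neg hQ h0 ha]
    · rcases eq_or_ne a b with rfl | hab
      · simp [ha]; ring
      · have hm : a - b ≠ 0 := sub_ne_zero.2 hab
        rw [show b - a = -(a - b) by ring, kern_neg hQ h0 hm]
        simp only [ha, hb, hab, if_false]
        have e : Q ^ (6 * a) = Q ^ (6 * b) * Q ^ (6 * (a - b)) := by
          rw [← zpow_add₀ h0]; ring_nf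
        have h1 := one_sub_zpow_ne_zero hQ ha
        have h2 := one_sub_zpow_ne_zero hQ hb
        have h3 := one_sub_zpow_ne_zero hQ hm
        unfold kern
        rw [e] at h1 ⊢
        generalize Q ^ (6 * b) = Y at *
        generalize Q ^ (6 * (a - b)) = M at *
        field_simp
        ring

lemma hasSum_lam_mul (hQ : ‖Q‖ < 1) (h0 : Q ≠ 0) (i j : ℕ) {s t : ℤ} (hs : 1 ≤ s) (hs' : s ≤ 5)
    (ht : 1 ≤ t) (ht' : t ≤ 5) :
    HasSum (fun x : ℤ × ℤ => lamTerm Q i s x.1 * lamTerm Q j t x.2) (lam Q i s * lam Q j t) :=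
  (hasSum_lam hQ h0 i hs hs').mul (hasSum_lam hQ h0 j ht ht')
    (summable_mul_of_summable_norm (summable_norm_lamTerm hQ h0 i hs hs')
      (summable_norm_lamTerm hQ h0 j ht ht'))

/-- The bijection `(a, b) ↦ (b, a - b)` of `ℤ × ℤ`. -/
def shear : ℤ × ℤ ≃ ℤ × ℤ where
  toFun x := (x.2, x.1 - x.2)
  invFun y := (y.1 + y.2, y.1)
  left_inv x := by ext <;> simp
  right_inv y := by ext <;> simp

/-- The bijection `(a, b) ↦ (a, b - a)` of `ℤ × ℤ`. -/
def shear' : ℤ × ℤ ≃ ℤ × ℤ where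
  toFun x := (x.1, x.2 - x.1)
  invFun y := (y.1, y.1 + y.2)
  left_inv x := by ext <;> simp
  right_inv y := by ext <;> simp

lemma hasSum_diag {g : ℤ → ℂ} {c : ℂ} (h : HasSum g c) :
    HasSum (fun x : ℤ × ℤ => if x.1 = x.2 then g x.1 else 0) c := by
  have hi : Function.Injective fun n : ℤ => (n, n) := fun a b hab => by simpa using hab
  refine (hi.hasSum_iff fun x hx => if_neg fun e => hx ⟨x.1, Prod.ext rfl e⟩).1 ?_
  simpa [Function.comp_def] using h

lemma hasSum_left {g : ℤ → ℂ} {c : ℂ} (h : HasSum g c) :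
    HasSum (fun x : ℤ × ℤ => if x.1 = 0 then g x.2 else 0) c := by
  have hi : Function.Injective fun n : ℤ => ((0 : ℤ), n) := fun a b hab => by simpa using hab
  refine (hi.hasSum_iff fun x hx => if_neg fun e => hx ⟨x.2, Prod.ext e.symm rfl⟩).1 ?_
  simpa [Function.comp_def] using h

lemma hasSum_right {g : ℤ → ℂ} {c : ℂ} (h : HasSum g c) :
    HasSum (fun x : ℤ × ℤ => if x.2 = 0 then g x.1 else 0) c := by
  have hi : Function.Injective fun n : ℤ => (n, (0 : ℤ)) := fun a b hab => by simpa using hab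
  refine (hi.hasSum_iff fun x hx => if_neg fun e => hx ⟨x.1, Prod.ext rfl e.symm⟩).1 ?_
  simpa [Function.comp_def] using h

/-- The sum of `kern_addition` over all pairs `(a, b)`, with a weight `φ`. -/
lemma hasSum_kern_addition (hQ : ‖Q‖ < 1) (h0 : Q ≠ 0) (φ : ℤ → ℤ → ℂ) {s t : ℤ} {X Y Z : ℂ}
    (hX : HasSum (fun a => φ a a * (kern Q a - kern Q a * (1 - kern Q a)) * Q ^ ((s + t) * a)) X)
    (hY : HasSum (fun b => φ 0 b * (kern Q b * (1 - kern Q b)) * Q ^ (t * b)) Y)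
    (hZ : HasSum (fun a => φ a 0 * (kern Q a * (1 - kern Q a)) * Q ^ (s * a)) Z) :
    HasSum (fun x : ℤ × ℤ => φ x.1 x.2 * (kern Q x.1 * kern Q x.2 -
      kern Q x.2 * kern Q (x.1 - x.2) - kern Q x.1 * kern Q (x.2 - x.1)) *
      (Q ^ (s * x.1) * Q ^ (t * x.2))) (X - Y - Z) := by
  refine (((hasSum_diag hX).sub (hasSum_left hY)).sub (hasSum_right hZ)).congr_fun ?_
  rintro ⟨a, b⟩
  simp only [kern_addition hQ h0 a b, mul_sub, sub_mul]
  congr 1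
  · congr 1
    · split_ifs with h
      · subst h; rw [add_mul, zpow_add₀ h0]; ring
      · simp
    · split_ifs with h
      · subst h; simp; ring
      · simp
  · split_ifs with h
    · subst h; simp; ring
    · simp

/-- The addition formula of the Weierstrass zeta function at the points `s τ`, `t τ`
of the torus with periods `1`, `6 τ`. -/
lemma lam_addition (hQ : ‖Q‖ < 1) (h0 : Q ≠ 0) {s t : ℤ} (hs : 1 ≤ s) (ht : 1 ≤ t)
    (hst : s + t ≤ 5) :
    lam Q 0 s * lam Q 0 t - lam Q 0 (s + t) * (lam Q 0 s + lam Q 0 t) =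
      lam Q 0 (s + t) - dlam Q 0 (s + t) - dlam Q 0 s - dlam Q 0 t := by
  have h1 : 1 ≤ s + t := by omega
  have h2 : s ≤ 5 := by omega
  have h3 : t ≤ 5 := by omega
  -- the three products as sums over the same pairs `(a, b)`, where `w₁^a w₂^b` has the coefficients
  -- `k_a k_b`, `k_b k_(a - b)` and `k_a k_(b - a)`
  have L := ((hasSum_lam_mul hQ h0 0 0 hs h2 ht h3).sub
    (shear.hasSum_iff.2 (hasSum_lam_mul hQ h0 0 0 h1 hst hs h2))).sub
    (shear'.hasSum_iff.2 (hasSum_lam_mul hQ h0 0 0 h1 hst ht h3))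
  have R := hasSum_kern_addition hQ h0 (fun _ _ => 1) (s := s) (t := t)
    (((hasSum_lam hQ h0 0 h1 hst).sub (hasSum_dlam hQ h0 0 h1 hst)).congr_fun
      fun a => by simp only [lamTerm, dlamTerm]; ring)
    ((hasSum_dlam hQ h0 0 ht h3).congr_fun fun a => by simp only [dlamTerm]; ring)
    ((hasSum_dlam hQ h0 0 hs h2).congr_fun fun a => by simp only [dlamTerm]; ring)
  have key := L.unique (R.congr_fun ?_)
  · linear_combination key
  · rintro ⟨a, b⟩
    have e1 : Q ^ ((s + t) * b) * Q ^ (s * (a - b)) = Q ^ (s * a) * Q ^ (t * b) := by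
      rw [← zpow_add₀ h0, ← zpow_add₀ h0]; ring_nf
    have e2 : Q ^ ((s + t) * a) * Q ^ (t * (b - a)) = Q ^ (s * a) * Q ^ (t * b) := by
      rw [← zpow_add₀ h0, ← zpow_add₀ h0]; ring_nf
    simp only [lamTerm, shear, shear', Function.comp_apply, Equiv.coe_fn_mk]
    linear_combination -(kern Q b * kern Q (a - b)) * e1 - (kern Q a * kern Q (b - a)) * e2

/-- The derivative of the addition formula in the direction that keeps `s + t` fixed. -/
lemma lam_addition_deriv (hQ : ‖Q‖ < 1) (h0 : Q ≠ 0) {s t : ℤ} (hs : 1 ≤ s) (ht : 1 ≤ t)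
    (hst : s + t ≤ 5) :
    lam Q 1 s * lam Q 0 t - lam Q 0 s * lam Q 1 t - lam Q 0 (s + t) * (lam Q 1 s - lam Q 1 t) =
      dlam Q 1 t - dlam Q 1 s := by
  have h1 : 1 ≤ s + t := by omega
  have h2 : s ≤ 5 := by omega
  have h3 : t ≤ 5 := by omega
  have L := (((hasSum_lam_mul hQ h0 1 0 hs h2 ht h3).sub
    (hasSum_lam_mul hQ h0 0 1 hs h2 ht h3)).sub
    (shear.hasSum_iff.2 (hasSum_lam_mul hQ h0 0 1 h1 hst hs h2))).add
    (shear'.hasSum_iff.2 (hasSum_lam_mul hQ h0 0 1 h1 hst ht h3))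
  have R := hasSum_kern_addition hQ h0 (fun a b => (a : ℂ) - b) (s := s) (t := t) (X := 0)
    (hasSum_zero.congr_fun fun a => by simp)
    ((hasSum_dlam hQ h0 1 ht h3).neg.congr_fun fun a => by simp [dlamTerm])
    ((hasSum_dlam hQ h0 1 hs h2).congr_fun fun a => by simp [dlamTerm])
  have key := L.unique (R.congr_fun ?_)
  · linear_combination key
  · rintro ⟨a, b⟩
    have e1 : Q ^ ((s + t) * b) * Q ^ (s * (a - b)) = Q ^ (s * a) * Q ^ (t * b) := by
      rw [← zpow_add₀ h0, ← zpow_add₀ h0]; ring_nf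
    have e2 : Q ^ ((s + t) * a) * Q ^ (t * (b - a)) = Q ^ (s * a) * Q ^ (t * b) := by
      rw [← zpow_add₀ h0, ← zpow_add₀ h0]; ring_nf
    simp only [lamTerm, shear, shear', Function.comp_apply, Equiv.coe_fn_mk]
    push_cast
    linear_combination -((a - b) * kern Q b * kern Q (a - b)) * e1 -
      ((a - b) * kern Q a * kern Q (b - a)) * e2

/-- A second derivative of the addition formula. -/
lemma lam_addition_deriv_deriv (hQ : ‖Q‖ < 1) (h0 : Q ≠ 0) {s t : ℤ} (hs : 1 ≤ s) (ht : 1 ≤ t)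
    (hst : s + t ≤ 5) :
    lam Q 0 s * lam Q 2 t - lam Q 1 s * lam Q 1 t - lam Q 0 (s + t) * lam Q 2 t
      + lam Q 1 (s + t) * (lam Q 1 s - lam Q 1 t) = -dlam Q 2 t := by
  have h1 : 1 ≤ s + t := by omega
  have h2 : s ≤ 5 := by omega
  have h3 : t ≤ 5 := by omega
  have L := ((((hasSum_lam_mul hQ h0 0 2 hs h2 ht h3).sub
    (hasSum_lam_mul hQ h0 1 1 hs h2 ht h3)).add
    (shear.hasSum_iff.2 (hasSum_lam_mul hQ h0 1 1 h1 hst hs h2))).sub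
    (shear'.hasSum_iff.2 (hasSum_lam_mul hQ h0 1 1 h1 hst ht h3))).sub
    (shear'.hasSum_iff.2 (hasSum_lam_mul hQ h0 0 2 h1 hst ht h3))
  have R := hasSum_kern_addition hQ h0 (fun a b => (b : ℂ) * (b - a)) (s := s) (t := t) (X := 0)
    (Z := 0) (hasSum_zero.congr_fun fun a => by simp)
    ((hasSum_dlam hQ h0 2 ht h3).congr_fun fun a => by simp [dlamTerm, pow_two])
    (hasSum_zero.congr_fun fun a => by simp)
  have key := L.unique (R.congr_fun ?_)
  · linear_combination key
  · rintro ⟨a, b⟩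
    have e1 : Q ^ ((s + t) * b) * Q ^ (s * (a - b)) = Q ^ (s * a) * Q ^ (t * b) := by
      rw [← zpow_add₀ h0, ← zpow_add₀ h0]; ring_nf
    have e2 : Q ^ ((s + t) * a) * Q ^ (t * (b - a)) = Q ^ (s * a) * Q ^ (t * b) := by
      rw [← zpow_add₀ h0, ← zpow_add₀ h0]; ring_nf
    simp only [lamTerm, shear, shear', Function.comp_apply, Equiv.coe_fn_mk]
    push_cast
    linear_combination -(b * (b - a) * kern Q b * kern Q (a - b)) * e1 -
      (b * (b - a) * kern Q a * kern Q (b - a)) * e2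

/-! ### Logarithmic derivatives of the eta products -/

/-- The Lambert series `∑ n x^n / (1 - x^n) = ∑ σ(n) x^n`. -/
def sigmaSum (x : ℂ) : ℂ := ∑' n : ℕ, n * x ^ n / (1 - x ^ n)

lemma hasSum_sigmaSum {x : ℂ} (hx : ‖x‖ < 1) :
    HasSum (fun n : ℕ => n * x ^ n / (1 - x ^ n)) (sigmaSum x) := by
  have h := (summable_norm_pow_mul_geometric_div_one_sub 1 hx).hasSum
  simpa [sigmaSum] using! h

lemma summable_pow_div_one_sub_sq {x : ℂ} (hx : ‖x‖ < 1) :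
    Summable fun n : ℕ => x ^ n / (1 - x ^ n) ^ 2 := by
  have h3 : 0 < 1 - ‖x‖ := by linarith
  refine .of_norm_bounded (g := fun n => ‖x‖ ^ n * (1 / (1 - ‖x‖) ^ 2))
    ((summable_geometric_of_lt_one (norm_nonneg _) hx).mul_right _) fun n => ?_
  rcases Nat.eq_zero_or_pos n with rfl | hn
  · simp; positivity
  · have h : 1 - ‖x‖ ≤ ‖1 - x ^ n‖ := by
      have h1 : ‖x ^ n‖ ≤ ‖x‖ := by
        rw [norm_pow]; exact pow_le_of_le_one (norm_nonneg _) hx.le (by omega)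
      have h2 := norm_sub_norm_le (1 : ℂ) (x ^ n)
      rw [norm_one] at h2
      linarith
    rw [norm_div, norm_pow, norm_pow, div_eq_mul_one_div]
    gcongr

/-- Summing the double series `∑ n x^(m n)` first over `n`. -/
lemma hasSum_sigmaSum' {x : ℂ} (hx : ‖x‖ < 1) :
    HasSum (fun n : ℕ => x ^ n / (1 - x ^ n) ^ 2) (sigmaSum x) := by
  have h1 := (tsum_prod_pow_eq_tsum_sigma 1 hx).trans (tsum_pow_div_one_sub_eq_tsum_sigma hx 1).symm
  have h2 : ∀ d : ℕ+, ∑' c : ℕ+, (c : ℂ) ^ 1 * x ^ (d * c : ℕ) =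
      x ^ (d : ℕ) / (1 - x ^ (d : ℕ)) ^ 2 := by
    intro d
    have hd : ‖x ^ (d : ℕ)‖ < 1 := by
      rw [norm_pow]; exact pow_lt_one₀ (norm_nonneg _) hx d.ne_zero
    rw [← tsum_coe_mul_geometric_of_norm_lt_one hd,
      ← tsum_pnat_eq_tsum_of_eq_zero (f := fun n : ℕ => (n : ℂ) * (x ^ (d : ℕ)) ^ n) (by simp)]
    exact tsum_congr fun c => by rw [pow_one, pow_mul]
  simp_rw [h2, pow_one] at h1
  rw [tsum_pnat_eq_tsum_of_eq_zero (f := fun n : ℕ => x ^ n / (1 - x ^ n) ^ 2) (by simp),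
    tsum_pnat_eq_tsum_of_eq_zero (f := fun n : ℕ => (n : ℂ) * x ^ n / (1 - x ^ n)) (by simp)] at h1
  rw [sigmaSum, ← h1]
  exact (summable_pow_div_one_sub_sq hx).hasSum

/-- The Euler product `∏ (1 - x^n)`, `n ≥ 1`. -/
def eulerProd (x : ℂ) : ℂ := ∏' n : ℕ, (1 - x ^ (n + 1))

lemma eulerProd_ne_zero {x : ℂ} (hx : ‖x‖ < 1) : eulerProd x ≠ 0 := by
  have := tprod_one_add_ne_zero_of_summable (f := fun n : ℕ => -x ^ (n + 1))
    (fun n => by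
      rw [← sub_eq_add_neg]; exact one_sub_pow_ne_zero hx (by omega))
    (by simpa using (summable_nat_add_iff 1).mpr (summable_geometric_of_lt_one (norm_nonneg _) hx))
  simpa [eulerProd, sub_eq_add_neg] using this

lemma differentiableAt_eulerProd {x : ℂ} (hx : ‖x‖ < 1) : DifferentiableAt ℂ eulerProd x :=
  ModularForm.differentiableOn_tprod_one_sub_pow.differentiableAt
    (Metric.isOpen_ball.mem_nhds (by simpa using hx))

@[simp] lemma eulerProd_zero : eulerProd 0 = 1 := by simp [eulerProd]

lemma mul_deriv_eulerProd {x : ℂ} (hx : ‖x‖ < 1) :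
    x * deriv eulerProd x = -sigmaSum x * eulerProd x := by
  have hd : ∀ n : ℕ, logDeriv (fun y : ℂ => 1 - y ^ (n + 1)) x =
      -((n + 1) * x ^ n) / (1 - x ^ (n + 1)) := by
    intro n
    have : HasDerivAt (fun y : ℂ => 1 - y ^ (n + 1)) (-((n + 1) * x ^ n)) x := by
      simpa using (hasDerivAt_pow (n + 1) x).const_sub 1
    rw [logDeriv_apply, this.deriv]
  have hs := (hasSum_nat_add_iff' 1).2 (hasSum_sigmaSum hx)
  simp only [Finset.range_one, Finset.sum_singleton, Nat.cast_zero, zero_mul, zero_div,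
    sub_zero] at hs
  have e : ∀ n : ℕ, -(((n + 1 : ℕ) : ℂ) * x ^ (n + 1) / (1 - x ^ (n + 1))) =
      x * logDeriv (fun y : ℂ => 1 - y ^ (n + 1)) x := by
    intro n; rw [hd]; push_cast; ring
  have hs' := hs.neg.congr_fun (fun n => (e n).symm)
  rcases eq_or_ne x 0 with rfl | h0
  · rw [hs'.unique (hasSum_zero.congr_fun fun n => by simp)]; simp
  · have hs2 := hs'.mul_left x⁻¹
    simp only [inv_mul_cancel_left₀ h0] at hs2
    have h := logDeriv_tprod_eq_tsum (s := Metric.ball (0 : ℂ) 1) Metric.isOpen_ball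
      (x := x) (by simpa using hx) (f := fun (n : ℕ) y => 1 - y ^ (n + 1))
      (fun n => one_sub_pow_ne_zero hx (by omega)) (fun n => by fun_prop) hs2.summable
      ModularForm.multipliableLocallyUniformlyOn_one_sub_pow (eulerProd_ne_zero hx)
    rw [hs2.tsum_eq, logDeriv_apply] at h
    change deriv eulerProd x / eulerProd x = _ at h
    rw [div_eq_iff (eulerProd_ne_zero hx)] at h
    rw [h]; field_simp

lemma norm_pow_lt_one {Q : ℂ} (hQ : ‖Q‖ < 1) {d : ℕ} (hd : d ≠ 0) : ‖Q ^ d‖ < 1 := by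
  rw [norm_pow]; exact pow_lt_one₀ (norm_nonneg _) hQ hd

lemma hasDerivAt_eulerProd_pow {Q : ℂ} (hQ : ‖Q‖ < 1) (h0 : Q ≠ 0) {d : ℕ} (hd : d ≠ 0) :
    HasDerivAt (fun Q => eulerProd (Q ^ d))
      (Q⁻¹ * (-d * sigmaSum (Q ^ d) * eulerProd (Q ^ d))) Q := by
  have hx := norm_pow_lt_one hQ hd
  have h := (differentiableAt_eulerProd hx).hasDerivAt.comp Q (hasDerivAt_pow d Q)
  refine h.congr_deriv ?_
  have h1 := mul_deriv_eulerProd hx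
  obtain ⟨k, rfl⟩ := Nat.exists_eq_succ_of_ne_zero hd
  have e : -((k.succ : ℕ) : ℂ) * sigmaSum (Q ^ k.succ) * eulerProd (Q ^ k.succ) =
      k.succ * (Q ^ k.succ * deriv eulerProd (Q ^ k.succ)) := by rw [h1]; ring
  rw [e, Nat.succ_sub_one, pow_succ]
  field_simp

/-! ### The Lambert series in terms of `∑ σ(n) Q^(d n)`, `d ∣ 6` -/

lemma kern_natCast (n : ℕ) : kern Q n = 1 / (1 - (Q ^ n) ^ 6) := by
  rw [kern, mul_comm, zpow_mul]; norm_cast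

lemma lamTerm_add_neg (hQ : ‖Q‖ < 1) (h0 : Q ≠ 0) (j s : ℕ) (hs : s ≤ 6) (n : ℕ) :
    lamTerm Q j s n + lamTerm Q j s (-n) =
      n ^ j * ((Q ^ n) ^ s - (-1) ^ j * (Q ^ n) ^ (6 - s)) / (1 - (Q ^ n) ^ 6) := by
  have h1 : Q ^ ((s : ℤ) * n) = (Q ^ n) ^ s := by
    rw [mul_comm, zpow_mul]; norm_cast
  have h2 : (Q ^ n) ^ 6 * Q ^ ((s : ℤ) * (-n)) = (Q ^ n) ^ (6 - s) := by
    obtain ⟨t, ht⟩ := Nat.exists_eq_add_of_le hs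
    rw [ht, Nat.add_sub_cancel_left, ← pow_mul, ← pow_mul, ← zpow_natCast, ← zpow_natCast,
      ← zpow_add₀ h0]
    push_cast; ring_nf
  rw [lamTerm, lamTerm, kern_neg_natCast hQ h0, kern_natCast, h1, ← h2, mul_comm 6 n, pow_mul]
  push_cast
  rw [neg_pow (n : ℂ)]
  ring

lemma dlamTerm_add_neg (hQ : ‖Q‖ < 1) (h0 : Q ≠ 0) (s : ℕ) (hs : s ≤ 6) (n : ℕ) :
    dlamTerm Q 0 s n + dlamTerm Q 0 s (-n) =
      -((Q ^ n) ^ (6 + s) + (Q ^ n) ^ (6 - s)) / (1 - (Q ^ n) ^ 6) ^ 2 := by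
  have h1 : Q ^ ((s : ℤ) * n) = (Q ^ n) ^ s := by
    rw [mul_comm, zpow_mul]; norm_cast
  have h2 : (Q ^ n) ^ 6 * Q ^ ((s : ℤ) * (-n)) = (Q ^ n) ^ (6 - s) := by
    obtain ⟨t, ht⟩ := Nat.exists_eq_add_of_le hs
    rw [ht, Nat.add_sub_cancel_left, ← pow_mul, ← pow_mul, ← zpow_natCast, ← zpow_natCast,
      ← zpow_add₀ h0]
    push_cast; ring_nf
  rcases Nat.eq_zero_or_pos n with rfl | hn
  · simp [dlamTerm]
  have h3 : 1 - (Q ^ n) ^ 6 ≠ 0 := by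
    rw [← pow_mul]; exact one_sub_pow_ne_zero hQ (by omega)
  rw [dlamTerm, dlamTerm, kern_neg_natCast hQ h0, kern_natCast, h1, ← h2, mul_comm 6 n, pow_mul,
    pow_add]
  field_simp
  ring

lemma hasSum_nat_of_int {g : ℤ → ℂ} {c : ℂ} (h : HasSum g c) (hg : g 0 = 0) :
    HasSum (fun n : ℕ => g n + g (-n)) c := by
  simpa [hg] using h.nat_add_neg

lemma hasSum_sigmaSum_pow (hQ : ‖Q‖ < 1) {d : ℕ} (hd : d ≠ 0) :
    HasSum (fun n : ℕ => n * (Q ^ n) ^ d / (1 - (Q ^ n) ^ d)) (sigmaSum (Q ^ d)) := by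
  simpa only [← pow_mul, mul_comm d] using! hasSum_sigmaSum (norm_pow_lt_one hQ hd)

lemma hasSum_sigmaSum_pow' (hQ : ‖Q‖ < 1) {d : ℕ} (hd : d ≠ 0) :
    HasSum (fun n : ℕ => (Q ^ n) ^ d / (1 - (Q ^ n) ^ d) ^ 2) (sigmaSum (Q ^ d)) := by
  simpa only [← pow_mul, mul_comm d] using! hasSum_sigmaSum' (norm_pow_lt_one hQ hd)

/-- A variable `X = Q^n`, `n ≥ 1`, is not a root of unity. -/
lemma nonzero_factors (hQ : ‖Q‖ < 1) {n : ℕ} (hn : n ≠ 0) :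
    1 - Q ^ n ≠ 0 ∧ 1 - (Q ^ n) ^ 2 ≠ 0 ∧ 1 - (Q ^ n) ^ 3 ≠ 0 ∧ 1 - (Q ^ n) ^ 6 ≠ 0 := by
  refine ⟨one_sub_pow_ne_zero hQ hn, ?_, ?_, ?_⟩ <;>
    exact one_sub_pow_ne_zero (norm_pow_lt_one hQ hn) (by omega)

lemma lam_one_one (hQ : ‖Q‖ < 1) (h0 : Q ≠ 0) :
    lam Q 1 1 = sigmaSum Q - sigmaSum (Q ^ 2) - sigmaSum (Q ^ 3) + sigmaSum (Q ^ 6) := by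
  have h1 := hasSum_sigmaSum_pow hQ one_ne_zero
  have h2 := hasSum_sigmaSum_pow hQ two_ne_zero
  have h3 := hasSum_sigmaSum_pow hQ three_ne_zero
  have h6 := hasSum_sigmaSum_pow hQ (d := 6) (by norm_num)
  have L := hasSum_nat_of_int (hasSum_lam hQ h0 1 (s := 1) (by norm_num) (by norm_num))
    (by simp [lamTerm])
  simp only [pow_one] at h1
  refine L.unique ((((h1.sub h2).sub h3).add h6).congr_fun fun n => ?_)
  have := lamTerm_add_neg hQ h0 1 1 (by norm_num) n
  push_cast at this
  rw [this]
  rcases eq_or_ne n 0 with rfl | hn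
  · simp
  obtain ⟨e1, e2, e3, e6⟩ := nonzero_factors hQ hn
  generalize Q ^ n = X at *
  field_simp
  ring

lemma lam_one_two (hQ : ‖Q‖ < 1) (h0 : Q ≠ 0) :
    lam Q 1 2 = sigmaSum (Q ^ 2) - sigmaSum (Q ^ 6) := by
  have h2 := hasSum_sigmaSum_pow hQ two_ne_zero
  have h6 := hasSum_sigmaSum_pow hQ (d := 6) (by norm_num)
  have L := hasSum_nat_of_int (hasSum_lam hQ h0 1 (s := 2) (by norm_num) (by norm_num))
    (by simp [lamTerm])
  refine L.unique ((h2.sub h6).congr_fun fun n => ?_)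
  have := lamTerm_add_neg hQ h0 1 2 (by norm_num) n
  push_cast at this
  rw [this]
  rcases eq_or_ne n 0 with rfl | hn
  · simp
  obtain ⟨e1, e2, e3, e6⟩ := nonzero_factors hQ hn
  generalize Q ^ n = X at *
  field_simp
  ring

lemma lam_one_three (hQ : ‖Q‖ < 1) (h0 : Q ≠ 0) :
    lam Q 1 3 = 2 * (sigmaSum (Q ^ 3) - sigmaSum (Q ^ 6)) := by
  have h3 := hasSum_sigmaSum_pow hQ three_ne_zero
  have h6 := hasSum_sigmaSum_pow hQ (d := 6) (by norm_num)
  have L := hasSum_nat_of_int (hasSum_lam hQ h0 1 (s := 3) (by norm_num) (by norm_num))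
    (by simp [lamTerm])
  refine L.unique (((h3.sub h6).mul_left 2).congr_fun fun n => ?_)
  have := lamTerm_add_neg hQ h0 1 3 (by norm_num) n
  push_cast at this
  rw [this]
  rcases eq_or_ne n 0 with rfl | hn
  · simp
  obtain ⟨e1, e2, e3, e6⟩ := nonzero_factors hQ hn
  generalize Q ^ n = X at *
  field_simp
  ring

lemma dlam_zero_one (hQ : ‖Q‖ < 1) (h0 : Q ≠ 0) :
    6 * dlam Q 0 1 = lam Q 0 1 - (sigmaSum Q - 2 * sigmaSum (Q ^ 2) - 3 * sigmaSum (Q ^ 3) +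
      6 * sigmaSum (Q ^ 6)) := by
  have h1 := hasSum_sigmaSum_pow' hQ one_ne_zero
  have h2 := hasSum_sigmaSum_pow' hQ two_ne_zero
  have h3 := hasSum_sigmaSum_pow' hQ three_ne_zero
  have h6 := hasSum_sigmaSum_pow' hQ (d := 6) (by norm_num)
  have L := hasSum_nat_of_int (hasSum_lam hQ h0 0 (s := 1) (by norm_num) (by norm_num))
    (by simp [lamTerm])
  have D := hasSum_nat_of_int (hasSum_dlam hQ h0 0 (s := 1) (by norm_num) (by norm_num))
    (by simp [dlamTerm])
  simp only [pow_one] at h1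
  refine (D.mul_left 6).unique ((L.sub (((h1.sub (h2.mul_left 2)).sub (h3.mul_left 3)).add
    (h6.mul_left 6))).congr_fun fun n => ?_)
  have e := lamTerm_add_neg hQ h0 0 1 (by norm_num) n
  have e' := dlamTerm_add_neg hQ h0 1 (by norm_num) n
  push_cast at e e'
  rw [e, e']
  rcases eq_or_ne n 0 with rfl | hn
  · simp
  obtain ⟨e1, e2, e3, e6⟩ := nonzero_factors hQ hn
  generalize Q ^ n = X at *
  have f6 : 1 - X ^ 6 = (1 - X ^ 2) * (1 + X ^ 2 + X ^ 4) := by ring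
  have f6' : 1 - X ^ 6 = (1 - X ^ 3) * (1 + X ^ 3) := by ring
  have f6'' : 1 - X ^ 6 = (1 - X) * (1 + X + X ^ 2 + X ^ 3 + X ^ 4 + X ^ 5) := by ring
  have g1 : X / (1 - X) ^ 2 =
      X * (1 + X + X ^ 2 + X ^ 3 + X ^ 4 + X ^ 5) ^ 2 / (1 - X ^ 6) ^ 2 := by
    rw [div_eq_div_iff (pow_ne_zero _ e1) (pow_ne_zero _ e6), f6'']; ring
  have g2 : X ^ 2 / (1 - X ^ 2) ^ 2 = X ^ 2 * (1 + X ^ 2 + X ^ 4) ^ 2 / (1 - X ^ 6) ^ 2 := by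
    rw [div_eq_div_iff (pow_ne_zero _ e2) (pow_ne_zero _ e6), f6]; ring
  have g3 : X ^ 3 / (1 - X ^ 3) ^ 2 = X ^ 3 * (1 + X ^ 3) ^ 2 / (1 - X ^ 6) ^ 2 := by
    rw [div_eq_div_iff (pow_ne_zero _ e3) (pow_ne_zero _ e6), f6']; ring
  rw [g1, g2, g3]
  field_simp
  ring

lemma dlam_zero_two (hQ : ‖Q‖ < 1) (h0 : Q ≠ 0) :
    6 * dlam Q 0 2 = 2 * lam Q 0 2 - (2 * sigmaSum (Q ^ 2) - 6 * sigmaSum (Q ^ 6)) := by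
  have h2 := hasSum_sigmaSum_pow' hQ two_ne_zero
  have h6 := hasSum_sigmaSum_pow' hQ (d := 6) (by norm_num)
  have L := hasSum_nat_of_int (hasSum_lam hQ h0 0 (s := 2) (by norm_num) (by norm_num))
    (by simp [lamTerm])
  have D := hasSum_nat_of_int (hasSum_dlam hQ h0 0 (s := 2) (by norm_num) (by norm_num))
    (by simp [dlamTerm])
  refine (D.mul_left 6).unique (((L.mul_left 2).sub ((h2.mul_left 2).sub
    (h6.mul_left 6))).congr_fun fun n => ?_)
  have e := lamTerm_add_neg hQ h0 0 2 (by norm_num) n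
  have e' := dlamTerm_add_neg hQ h0 2 (by norm_num) n
  push_cast at e e'
  rw [e, e']
  rcases eq_or_ne n 0 with rfl | hn
  · simp
  obtain ⟨e1, e2, e3, e6⟩ := nonzero_factors hQ hn
  generalize Q ^ n = X at *
  have f6 : 1 - X ^ 6 = (1 - X ^ 2) * (1 + X ^ 2 + X ^ 4) := by ring
  have g2 : X ^ 2 / (1 - X ^ 2) ^ 2 = X ^ 2 * (1 + X ^ 2 + X ^ 4) ^ 2 / (1 - X ^ 6) ^ 2 := by
    rw [div_eq_div_iff (pow_ne_zero _ e2) (pow_ne_zero _ e6), f6]; ring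
  rw [g2]
  field_simp
  ring

lemma dlam_zero_four (hQ : ‖Q‖ < 1) (h0 : Q ≠ 0) :
    6 * dlam Q 0 4 = 4 * lam Q 0 4 - (2 * sigmaSum (Q ^ 2) - 6 * sigmaSum (Q ^ 6)) := by
  have h2 := hasSum_sigmaSum_pow' hQ two_ne_zero
  have h6 := hasSum_sigmaSum_pow' hQ (d := 6) (by norm_num)
  have L := hasSum_nat_of_int (hasSum_lam hQ h0 0 (s := 4) (by norm_num) (by norm_num))
    (by simp [lamTerm])
  have D := hasSum_nat_of_int (hasSum_dlam hQ h0 0 (s := 4) (by norm_num) (by norm_num))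
    (by simp [dlamTerm])
  refine (D.mul_left 6).unique (((L.mul_left 4).sub ((h2.mul_left 2).sub
    (h6.mul_left 6))).congr_fun fun n => ?_)
  have e := lamTerm_add_neg hQ h0 0 4 (by norm_num) n
  have e' := dlamTerm_add_neg hQ h0 4 (by norm_num) n
  push_cast at e e'
  rw [e, e']
  rcases eq_or_ne n 0 with rfl | hn
  · simp
  obtain ⟨e1, e2, e3, e6⟩ := nonzero_factors hQ hn
  generalize Q ^ n = X at *
  have f6 : 1 - X ^ 6 = (1 - X ^ 2) * (1 + X ^ 2 + X ^ 4) := by ring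
  have g2 : X ^ 2 / (1 - X ^ 2) ^ 2 = X ^ 2 * (1 + X ^ 2 + X ^ 4) ^ 2 / (1 - X ^ 6) ^ 2 := by
    rw [div_eq_div_iff (pow_ne_zero _ e2) (pow_ne_zero _ e6), f6]; ring
  rw [g2]
  field_simp
  ring

lemma dlam_zero_three (hQ : ‖Q‖ < 1) (h0 : Q ≠ 0) :
    6 * dlam Q 0 3 = -2 * (3 * sigmaSum (Q ^ 3) - 6 * sigmaSum (Q ^ 6)) := by
  have h3 := hasSum_sigmaSum_pow' hQ three_ne_zero
  have h6 := hasSum_sigmaSum_pow' hQ (d := 6) (by norm_num)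
  have D := hasSum_nat_of_int (hasSum_dlam hQ h0 0 (s := 3) (by norm_num) (by norm_num))
    (by simp [dlamTerm])
  refine (D.mul_left 6).unique ((((h3.mul_left 3).sub
    (h6.mul_left 6)).mul_left (-2)).congr_fun fun n => ?_)
  have e' := dlamTerm_add_neg hQ h0 3 (by norm_num) n
  push_cast at e'
  rw [e']
  rcases eq_or_ne n 0 with rfl | hn
  · simp
  obtain ⟨e1, e2, e3, e6⟩ := nonzero_factors hQ hn
  generalize Q ^ n = X at *
  have f6' : 1 - X ^ 6 = (1 - X ^ 3) * (1 + X ^ 3) := by ring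
  have g3 : X ^ 3 / (1 - X ^ 3) ^ 2 = X ^ 3 * (1 + X ^ 3) ^ 2 / (1 - X ^ 6) ^ 2 := by
    rw [div_eq_div_iff (pow_ne_zero _ e3) (pow_ne_zero _ e6), f6']; ring
  rw [g3]
  field_simp
  ring

/-! ### Derivatives of the Lambert series -/

/-- Differentiation with respect to `Q` raises the power of `n` by one; the term with `dlamTerm`
comes from the denominators. -/
lemma hasDerivAt_lamTerm (hQ : ‖Q‖ < 1) (h0 : Q ≠ 0) (j : ℕ) (s n : ℤ) :
    HasDerivAt (fun Q => lamTerm Q j s n)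
      (Q⁻¹ * (s * lamTerm Q (j + 1) s n - 6 * dlamTerm Q (j + 1) s n)) Q := by
  rcases eq_or_ne n 0 with rfl | hn
  · simp [lamTerm, dlamTerm, hasDerivAt_const]
  have hd := one_sub_zpow_ne_zero hQ hn
  have h1 := hasDerivAt_zpow (s * n) Q (Or.inl h0)
  have h2 := (hasDerivAt_zpow (6 * n) Q (Or.inl h0)).const_sub 1
  have h3 := ((((hasDerivAt_const Q (1 : ℂ)).div h2 hd).const_mul ((n : ℂ) ^ j)).mul h1)
  refine h3.congr_deriv ?_
  have e1 : Q ^ (s * n - 1) = Q⁻¹ * Q ^ (s * n) := by rw [zpow_sub₀ h0, zpow_one]; ring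
  have e2 : Q ^ (6 * n - 1) = Q⁻¹ * Q ^ (6 * n) := by rw [zpow_sub₀ h0, zpow_one]; ring
  simp only [lamTerm, dlamTerm, kern, e1, e2, Pi.div_apply]
  push_cast
  field_simp
  ring

lemma hasDerivAt_lam (hQ : ‖Q‖ < 1) (h0 : Q ≠ 0) (j : ℕ) {s : ℤ} (hs : 1 ≤ s) (hs' : s ≤ 5) :
    HasDerivAt (fun Q => lam Q j s)
      (Q⁻¹ * (s * lam Q (j + 1) s - 6 * dlam Q (j + 1) s)) Q := by
  obtain ⟨r, hr, hr1⟩ := exists_between hQ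
  have hr0 : 0 < r := (norm_nonneg Q).trans_lt hr
  have hU : IsOpen (Metric.ball (0 : ℂ) r \ {0}) := Metric.isOpen_ball.sdiff isClosed_singleton
  have hmem : ∀ w ∈ Metric.ball (0 : ℂ) r \ {0}, ‖w‖ < r ∧ w ≠ 0 := fun w hw => by
    simpa using hw
  have hzU : Q ∈ Metric.ball (0 : ℂ) r \ {0} := by simpa using ⟨hr, h0⟩
  have hs1 : Summable fun n : ℤ => 1 / (1 - r) * ‖((n.natAbs : ℂ)) ^ j * (r : ℂ) ^ n.natAbs‖ :=
    (summable_natAbs_pow_mul (by simpa [abs_of_pos hr0] using hr1) j).mul_left _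
  have hb : ∀ (n : ℤ) (w : ℂ), w ∈ Metric.ball (0 : ℂ) r \ {0} → ‖lamTerm w j s n‖ ≤
      1 / (1 - r) * ‖((n.natAbs : ℂ)) ^ j * (r : ℂ) ^ n.natAbs‖ := by
    intro n w hw
    obtain ⟨hw1, hw0⟩ := hmem w hw
    refine (norm_lamTerm_le (hw1.trans hr1) hw0 j hs hs' n).trans ?_
    have : 0 < 1 - r := by linarith
    simp only [norm_mul, norm_pow, Complex.norm_real, Real.norm_eq_abs, abs_of_pos hr0]
    gcongr
  have hd : ∀ n : ℤ, DifferentiableOn ℂ (fun w => lamTerm w j s n) (Metric.ball (0 : ℂ) r \ {0}) :=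
    fun n w hw => (hasDerivAt_lamTerm ((hmem w hw).1.trans hr1) (hmem w hw).2 j s
      n).differentiableAt.differentiableWithinAt
  have hD := (Complex.differentiableOn_tsum_of_summable_norm hs1 hd hU hb).differentiableAt
    (hU.mem_nhds hzU)
  have hS := Complex.hasSum_deriv_of_summable_norm hs1 hd hU hb hzU
  have hS' := (((hasSum_lam hQ h0 (j + 1) hs hs').mul_left (s : ℂ)).sub
    ((hasSum_dlam hQ h0 (j + 1) hs hs').mul_left 6)).mul_left Q⁻¹
  refine hD.hasDerivAt.congr_deriv (hS.unique (hS'.congr_fun fun n => ?_))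
  exact (hasDerivAt_lamTerm hQ h0 j s n).deriv

/-! ### The weight one functions and their differential system -/

/-- The Lambert series `∑ (Q^(s n) - Q^((6 - s) n)) / (1 - Q^(6 n))` over natural numbers,
which makes sense at `Q = 0` as well. -/
def lamNat (s : ℕ) (Q : ℂ) : ℂ :=
  ∑' n : ℕ, ((Q ^ n) ^ s - (Q ^ n) ^ (6 - s)) / (1 - (Q ^ n) ^ 6)

lemma lamNat_eq_lam (hQ : ‖Q‖ < 1) (h0 : Q ≠ 0) {s : ℕ} (hs : 1 ≤ s) (hs' : s ≤ 5) :
    lamNat s Q = lam Q 0 s := by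
  have L := hasSum_nat_of_int (hasSum_lam hQ h0 0 (s := s) (by omega) (by omega))
    (by simp [lamTerm])
  rw [← L.tsum_eq, lamNat]
  refine tsum_congr fun n => ?_
  rw [lamTerm_add_neg hQ h0 0 s (by omega) n]
  simp

lemma norm_lamNat_term_le {r : ℝ} (hr : r < 1) (hQ : ‖Q‖ < r) {s : ℕ} (hs : 1 ≤ s)
    (hs' : s ≤ 5) (n : ℕ) :
    ‖((Q ^ n) ^ s - (Q ^ n) ^ (6 - s)) / (1 - (Q ^ n) ^ 6)‖ ≤ 2 / (1 - r) * r ^ n := by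
  have h3 : 0 < 1 - r := by linarith
  have hr0 : 0 ≤ r := (norm_nonneg Q).trans hQ.le
  rcases Nat.eq_zero_or_pos n with rfl | hn
  · simp; positivity
  have hx : ‖Q ^ n‖ ≤ r ^ n := by rw [norm_pow]; gcongr
  have hx1 : r ^ n ≤ r := pow_le_of_le_one hr0 hr.le (by omega)
  have hp : ∀ k : ℕ, k ≠ 0 → ‖(Q ^ n) ^ k‖ ≤ r ^ n := fun k hk => by
    rw [norm_pow]
    exact (pow_le_of_le_one (norm_nonneg _) (by linarith) hk).trans hx
  have h1 : ‖(Q ^ n) ^ s - (Q ^ n) ^ (6 - s)‖ ≤ 2 * r ^ n := by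
    have := norm_sub_le ((Q ^ n) ^ s) ((Q ^ n) ^ (6 - s))
    linarith [hp s (by omega), hp (6 - s) (by omega)]
  have h2 : 1 - r ≤ ‖1 - (Q ^ n) ^ 6‖ := by
    have := norm_sub_norm_le (1 : ℂ) ((Q ^ n) ^ 6)
    rw [norm_one] at this
    linarith [hp 6 (by omega)]
  rw [norm_div, div_mul_eq_mul_div]
  gcongr

lemma differentiableOn_lamNat_term (s : ℕ) (n : ℕ) :
    DifferentiableOn ℂ (fun Q : ℂ => ((Q ^ n) ^ s - (Q ^ n) ^ (6 - s)) / (1 - (Q ^ n) ^ 6))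
      (Metric.ball 0 1) := by
  rcases Nat.eq_zero_or_pos n with rfl | hn
  · simp
  intro w hw
  have hw : ‖w‖ < 1 := by simpa using hw
  have := (nonzero_factors hw hn.ne').2.2.2
  apply DifferentiableAt.differentiableWithinAt
  fun_prop (disch := assumption)

lemma differentiableAt_lamNat (hQ : ‖Q‖ < 1) {s : ℕ} (hs : 1 ≤ s) (hs' : s ≤ 5) :
    DifferentiableAt ℂ (lamNat s) Q := by
  obtain ⟨r, hr, hr1⟩ := exists_between hQ
  have hr0 : 0 < r := (norm_nonneg Q).trans_lt hr
  refine (Complex.differentiableOn_tsum_of_summable_norm (U := Metric.ball 0 r)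
    ((summable_geometric_of_lt_one hr0.le hr1).mul_left (2 / (1 - r)))
    (fun n => (differentiableOn_lamNat_term s n).mono (Metric.ball_subset_ball hr1.le))
    Metric.isOpen_ball fun n w hw => norm_lamNat_term_le hr1 (by simpa using hw) hs hs' n)
    |>.differentiableAt (Metric.isOpen_ball.mem_nhds (by simpa using hr))

lemma lamNat_zero {s : ℕ} (hs : 1 ≤ s) (hs' : s ≤ 5) : lamNat s 0 = 0 := by
  rw [lamNat, ← tsum_zero (β := ℕ)]
  refine tsum_congr fun n => ?_
  rcases Nat.eq_zero_or_pos n with rfl | hn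
  · simp
  · simp [hn.ne', show s ≠ 0 by omega, show 6 - s ≠ 0 by omega]

lemma hasDerivAt_lamNat_zero {s : ℕ} (hs : 1 ≤ s) (hs' : s ≤ 2) :
    HasDerivAt (lamNat s) (if s = 1 then 1 else 0) 0 := by
  have hd := (differentiableAt_lamNat (Q := 0) (s := s) (by simp) hs (by omega)).hasDerivAt
  refine hd.congr_deriv ?_
  have hS := Complex.hasSum_deriv_of_summable_norm (U := Metric.ball 0 (1 / 2)) (z := 0)
    ((summable_geometric_of_lt_one (by norm_num) (by norm_num)).mul_left (2 / (1 - 1 / 2 : ℝ)))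
    (fun n => (differentiableOn_lamNat_term s n).mono (Metric.ball_subset_ball (by norm_num)))
    Metric.isOpen_ball
    (fun n w hw => norm_lamNat_term_le (by norm_num) (by simpa using hw) hs (by omega) n)
    (by simp)
  refine hS.unique ((hasSum_ite_eq (1 : ℕ) (if s = 1 then (1 : ℂ) else 0)).congr_fun fun n => ?_)
  rcases Nat.eq_zero_or_pos n with rfl | hn
  · simp
  have h1 : HasDerivAt (fun Q : ℂ => ((Q ^ n) ^ s - (Q ^ n) ^ (6 - s)) / (1 - (Q ^ n) ^ 6)) _ 0 :=
    (((((hasDerivAt_id (0 : ℂ)).pow n).pow s).sub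
      (((hasDerivAt_id (0 : ℂ)).pow n).pow (6 - s))).div
      ((((hasDerivAt_id (0 : ℂ)).pow n).pow 6).const_sub 1) (by simp [hn.ne']))
  rw [h1.deriv]
  rcases eq_or_ne n 1 with rfl | hn1
  · interval_cases s <;> simp
  · simp [hn.ne', hn1, show n - 1 ≠ 0 by omega, show s ≠ 0 by omega, show 6 - s ≠ 0 by omega]

/-- The weight one modular form `1 + 3 ∑ (Q^n - Q^(5 n)) / (1 - Q^(6 n))`, which turns out to be
the eta quotient `f₂`. -/
def fSer (Q : ℂ) : ℂ := 1 + 3 * lamNat 1 Q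

/-- The weight one modular form `1 + 6 ∑ (Q^(2 n) - Q^(4 n)) / (1 - Q^(6 n))`, which is the theta
function of the hexagonal lattice at `Q²`. -/
def bSer (Q : ℂ) : ℂ := 1 + 6 * lamNat 2 Q

/-- The quasimodular form `∑ n Q^(3 n) / (1 - Q^(6 n))` over nonzero integers `n`. -/
abbrev mSer (Q : ℂ) : ℂ := lam Q 1 3

lemma fSer_eq (hQ : ‖Q‖ < 1) (h0 : Q ≠ 0) : fSer Q = 1 + 3 * lam Q 0 1 := by
  rw [fSer, lamNat_eq_lam hQ h0 le_rfl (by norm_num)]; rfl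

lemma bSer_eq (hQ : ‖Q‖ < 1) (h0 : Q ≠ 0) : bSer Q = 1 + 6 * lam Q 0 2 := by
  rw [bSer, lamNat_eq_lam hQ h0 (by norm_num) (by norm_num)]; rfl

lemma lam_reflections (hQ : ‖Q‖ < 1) (h0 : Q ≠ 0) :
    lam Q 0 3 = 0 ∧ lam Q 0 4 = -lam Q 0 2 ∧ lam Q 0 5 = -lam Q 0 1 ∧
      lam Q 1 5 = lam Q 1 1 ∧ lam Q 2 3 = 0 := by
  have h1 := lam_reflect hQ h0 0 3
  have h2 := lam_reflect hQ h0 0 2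
  have h3 := lam_reflect hQ h0 0 1
  have h4 := lam_reflect hQ h0 1 1
  have h5 := lam_reflect hQ h0 2 3
  norm_num at h1 h2 h3 h4 h5
  exact ⟨CharZero.eq_neg_self_iff.1 h1, h2, h3, h4, CharZero.eq_neg_self_iff.1 h5⟩

/-- The squares and the product of the two weight one forms are Eisenstein series. -/
lemma fSer_bSer_quadratic (hQ : ‖Q‖ < 1) (h0 : Q ≠ 0) :
    fSer Q ^ 2 = 1 + 6 * sigmaSum Q - 3 * sigmaSum (Q ^ 2) - 27 * sigmaSum (Q ^ 6) ∧
    fSer Q * bSer Q = 1 + 3 * sigmaSum Q + 9 * sigmaSum (Q ^ 3) - 36 * sigmaSum (Q ^ 6) ∧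
    bSer Q ^ 2 = 1 + 12 * sigmaSum (Q ^ 2) - 36 * sigmaSum (Q ^ 6) := by
  obtain ⟨h3, h4, -, -, -⟩ := lam_reflections hQ h0
  have a11 := lam_addition hQ h0 (s := 1) (t := 1) (by norm_num) (by norm_num) (by norm_num)
  have a12 := lam_addition hQ h0 (s := 1) (t := 2) (by norm_num) (by norm_num) (by norm_num)
  have a22 := lam_addition hQ h0 (s := 2) (t := 2) (by norm_num) (by norm_num) (by norm_num)
  norm_num at a11 a12 a22
  have d1 := dlam_zero_one hQ h0
  have d2 := dlam_zero_two hQ h0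
  have d3 := dlam_zero_three hQ h0
  have d4 := dlam_zero_four hQ h0
  rw [h4] at a22 d4
  rw [h3] at a12
  rw [fSer_eq hQ h0, bSer_eq hQ h0]
  refine ⟨?_, ?_, ?_⟩
  · linear_combination 9 * a11 + 18 * a12 - 6 * d1 - 9 / 2 * d2 - 3 * d3
  · linear_combination 18 * a12 - 3 * d1 - 3 * d2 - 3 * d3
  · linear_combination 12 * a22 - 4 * d2 - 2 * d4

/-- Differences of the quasimodular forms at the points `τ`, `2 τ`, `3 τ` are modular. -/
lemma lam_sub_mSer (hQ : ‖Q‖ < 1) (h0 : Q ≠ 0) :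
    lam Q 1 1 - mSer Q = fSer Q * (fSer Q - bSer Q) / 3 ∧
      lam Q 1 2 - mSer Q = (fSer Q - bSer Q) ^ 2 / 9 := by
  obtain ⟨h1, h2, h3⟩ := fSer_bSer_quadratic hQ h0
  rw [lam_one_one hQ h0, lam_one_two hQ h0, mSer, lam_one_three hQ h0]
  constructor
  · linear_combination (-1 / 3 : ℂ) * h1 + (1 / 3 : ℂ) * h2
  · linear_combination (-1 / 9 : ℂ) * h1 + (2 / 9 : ℂ) * h2 - (1 / 9 : ℂ) * h3

lemma punctured_eventually (hQ : ‖Q‖ < 1) (h0 : Q ≠ 0) : ∀ᶠ w in nhds Q, ‖w‖ < 1 ∧ w ≠ 0 :=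
  (continuous_norm.continuousAt.eventually_lt_const hQ).and (eventually_ne_nhds h0)

/-- The Lambert series vanishes identically at the half period `3 τ`, which determines its partial
derivative there. -/
lemma dlam_one_three (hQ : ‖Q‖ < 1) (h0 : Q ≠ 0) : 6 * dlam Q 1 3 = 3 * mSer Q := by
  have h := hasDerivAt_lam hQ h0 0 (s := 3) (by norm_num) (by norm_num)
  have h' : HasDerivAt (fun Q => lam Q 0 3) 0 Q :=
    (hasDerivAt_const Q (0 : ℂ)).congr_of_eventuallyEq <| by
      filter_upwards [punctured_eventually hQ h0] with w hw
      exact (lam_reflections hw.1 hw.2).1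
  have := h.unique h'
  simp only [mul_eq_zero, inv_eq_zero, h0, false_or] at this
  push_cast at this
  linear_combination -this

/-- The functions `fSer`, `bSer`, `mSer` satisfy a closed system of differential equations. It
consists of the derivatives of the addition formula at the points `τ`, `2 τ`, `3 τ`. -/
lemma hasDerivAt_fSer (hQ : ‖Q‖ < 1) (h0 : Q ≠ 0) :
    HasDerivAt fSer (Q⁻¹ * (fSer Q * (bSer Q * (fSer Q - bSer Q) - 6 * mSer Q))) Q := by
  have h : HasDerivAt (fun Q => 1 + 3 * lam Q 0 1) _ Q :=
    ((hasDerivAt_lam hQ h0 0 (s := 1) (by norm_num) (by norm_num)).const_mul 3).const_add 1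
  refine (h.congr_of_eventuallyEq ?_).congr_deriv ?_
  · filter_upwards [punctured_eventually hQ h0] with w hw using fSer_eq hw.1 hw.2
  obtain ⟨h3, h4, -, -, -⟩ := lam_reflections hQ h0
  have a := lam_addition_deriv hQ h0 (s := 1) (t := 3) (by norm_num) (by norm_num) (by norm_num)
  norm_num at a
  rw [h3, h4] at a
  have e := (lam_sub_mSer hQ h0).1
  have e3 := dlam_one_three hQ h0
  have ef := fSer_eq hQ h0
  have eb := bSer_eq hQ h0
  rw [mul_left_comm]
  congr 1
  push_cast
  linear_combination -18 * a + 3 * bSer Q * e - 3 * e3 + 6 * lam Q 1 3 * ef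
    - 3 * (lam Q 1 1 - lam Q 1 3) * eb

lemma hasDerivAt_bSer (hQ : ‖Q‖ < 1) (h0 : Q ≠ 0) :
    HasDerivAt bSer
      (Q⁻¹ * (4 / 3 * fSer Q * (fSer Q - bSer Q) ^ 2 - 6 * bSer Q * mSer Q)) Q := by
  have h : HasDerivAt (fun Q => 1 + 6 * lam Q 0 2) _ Q :=
    ((hasDerivAt_lam hQ h0 0 (s := 2) (by norm_num) (by norm_num)).const_mul 6).const_add 1
  refine (h.congr_of_eventuallyEq ?_).congr_deriv ?_
  · filter_upwards [punctured_eventually hQ h0] with w hw using bSer_eq hw.1 hw.2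
  obtain ⟨h3, -, h5, -, -⟩ := lam_reflections hQ h0
  have a := lam_addition_deriv hQ h0 (s := 2) (t := 3) (by norm_num) (by norm_num) (by norm_num)
  norm_num at a
  rw [h3, h5] at a
  have e := (lam_sub_mSer hQ h0).2
  have e3 := dlam_one_three hQ h0
  have ef := fSer_eq hQ h0
  have eb := bSer_eq hQ h0
  rw [mul_left_comm]
  congr 1
  push_cast
  linear_combination -36 * a + 12 * fSer Q * e - 6 * e3 - 12 * (lam Q 1 2 - lam Q 1 3) * ef
    + 6 * lam Q 1 3 * eb

lemma hasDerivAt_mSer (hQ : ‖Q‖ < 1) (h0 : Q ≠ 0) :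
    HasDerivAt mSer
      (Q⁻¹ * (2 / 9 * fSer Q * (fSer Q - bSer Q) ^ 3 - 6 * mSer Q ^ 2)) Q := by
  refine (hasDerivAt_lam hQ h0 1 (s := 3) (by norm_num) (by norm_num)).congr_deriv ?_
  obtain ⟨-, -, -, h15, h23⟩ := lam_reflections hQ h0
  have a := lam_addition_deriv_deriv hQ h0 (s := 2) (t := 3) (by norm_num) (by norm_num)
    (by norm_num)
  norm_num at a
  rw [h15, h23] at a
  obtain ⟨e1, e2⟩ := lam_sub_mSer hQ h0
  congr 1
  norm_num
  rw [h23]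
  simp only [mSer] at *
  have E1 : lam Q 1 1 = lam Q 1 3 + fSer Q * (fSer Q - bSer Q) / 3 := by linear_combination e1
  have E2 : lam Q 1 2 = lam Q 1 3 + (fSer Q - bSer Q) ^ 2 / 9 := by linear_combination e2
  rw [E1, E2] at a
  linear_combination -6 * a

/-! ### Identification of the weight one functions with eta quotients -/

/-- A holomorphic function on a disc whose derivative vanishes off the centre is constant. -/
lemma eq_zero_value_of_deriv_eq_zero {g : ℂ → ℂ} {r : ℝ}
    (hd : DifferentiableOn ℂ g (Metric.ball 0 r))
    (h : ∀ Q ∈ Metric.ball (0 : ℂ) r, Q ≠ 0 → deriv g Q = 0) {Q : ℂ}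
    (hQ : Q ∈ Metric.ball (0 : ℂ) r) : g Q = g 0 := by
  have hr : 0 < r := (norm_nonneg Q).trans_lt (by simpa using hQ)
  have h0 : (0 : ℂ) ∈ Metric.ball (0 : ℂ) r := by simpa using hr
  have hc : ContinuousAt (deriv g) 0 :=
    (hd.deriv Metric.isOpen_ball).continuousOn.continuousAt (Metric.isOpen_ball.mem_nhds h0)
  have hz : deriv g 0 = 0 := by
    refine tendsto_nhds_unique (hc.tendsto.mono_left nhdsWithin_le_nhds)
      (tendsto_const_nhds.congr' (f₁ := fun _ => (0 : ℂ)) (l₁ := nhdsWithin 0 {0}ᶜ) ?_)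
    filter_upwards [self_mem_nhdsWithin, mem_nhdsWithin_of_mem_nhds
      (Metric.isOpen_ball.mem_nhds h0)] with w hw hw'
    exact (h w hw' hw).symm
  refine Metric.isOpen_ball.is_const_of_deriv_eq_zero (convex_ball 0 r).isPreconnected hd
    (fun w hw => ?_) hQ h0
  rcases eq_or_ne w 0 with rfl | hw0
  · exact hz
  · exact h w hw hw0

/-- Two holomorphic functions on the unit disc with the same logarithmic derivative off the centre
and the same value at the centre agree. -/
lemma eq_of_same_logDeriv {g D R : ℂ → ℂ} (hg : ∀ Q : ℂ, ‖Q‖ < 1 → DifferentiableAt ℂ g Q)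
    (hD : ∀ Q : ℂ, ‖Q‖ < 1 → DifferentiableAt ℂ D Q) (hD0 : ∀ Q : ℂ, ‖Q‖ < 1 → D Q ≠ 0)
    (hg' : ∀ Q : ℂ, ‖Q‖ < 1 → Q ≠ 0 → HasDerivAt g (Q⁻¹ * (R Q * g Q)) Q)
    (hD' : ∀ Q : ℂ, ‖Q‖ < 1 → Q ≠ 0 → HasDerivAt D (Q⁻¹ * (R Q * D Q)) Q)
    (h0 : g 0 = D 0) {Q : ℂ} (hQ : ‖Q‖ < 1) : g Q = D Q := by
  have hb : ∀ w ∈ Metric.ball (0 : ℂ) 1, ‖w‖ < 1 := fun w hw => by simpa using hw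
  have h := eq_zero_value_of_deriv_eq_zero (g := fun w => g w / D w) (r := 1)
    (fun w hw => ((hg w (hb w hw)).div (hD w (hb w hw))
      (hD0 w (hb w hw))).differentiableWithinAt)
    (fun w hw hw0 => by
      rw [((hg' w (hb w hw) hw0).fun_div (hD' w (hb w hw) hw0) (hD0 w (hb w hw))).deriv,
        div_eq_zero_iff]
      left; ring)
    (Q := Q) (by simpa using hQ)
  rw [h0, div_self (hD0 0 (by simp)), div_eq_one_iff_eq (hD0 Q hQ)] at h
  exact h

/-- The quotient of Euler products `∏_{d ∣ 6} ∏_n (1 - Q^(d n))^(r_d)`, with the exponents `r_d`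
in the order `d = 1, 2, 3, 6`. -/
def eulerQuot (a b c d : ℤ) (Q : ℂ) : ℂ :=
  eulerProd Q ^ a * eulerProd (Q ^ 2) ^ b * eulerProd (Q ^ 3) ^ c * eulerProd (Q ^ 6) ^ d

lemma eulerProd_pow_ne_zero (hQ : ‖Q‖ < 1) {d : ℕ} (hd : d ≠ 0) : eulerProd (Q ^ d) ≠ 0 :=
  eulerProd_ne_zero (norm_pow_lt_one hQ hd)

lemma eulerQuot_ne_zero (hQ : ‖Q‖ < 1) (a b c d : ℤ) : eulerQuot a b c d Q ≠ 0 := by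
  have h1 := eulerProd_ne_zero hQ
  have h2 := eulerProd_pow_ne_zero hQ (d := 2) (by norm_num)
  have h3 := eulerProd_pow_ne_zero hQ (d := 3) (by norm_num)
  have h6 := eulerProd_pow_ne_zero hQ (d := 6) (by norm_num)
  unfold eulerQuot
  positivity

@[simp] lemma eulerQuot_zero (a b c d : ℤ) : eulerQuot a b c d 0 = 1 := by simp [eulerQuot]

lemma differentiableAt_eulerQuot (hQ : ‖Q‖ < 1) (a b c d : ℤ) :
    DifferentiableAt ℂ (eulerQuot a b c d) Q := by
  have key : ∀ k : ℕ, k ≠ 0 → ∀ e : ℤ,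
      DifferentiableAt ℂ (fun Q => eulerProd (Q ^ k) ^ e) Q := fun k hk e =>
    ((differentiableAt_eulerProd (norm_pow_lt_one hQ hk)).comp Q
      (differentiableAt_pow k)).zpow (Or.inl (eulerProd_pow_ne_zero hQ hk))
  have h1 := key 1 one_ne_zero a
  simp only [pow_one] at h1
  exact ((h1.mul (key 2 (by norm_num) b)).mul (key 3 (by norm_num) c)).mul
    (key 6 (by norm_num) d)

lemma hasDerivAt_eulerQuot (hQ : ‖Q‖ < 1) (h0 : Q ≠ 0) (a b c d : ℤ) :
    HasDerivAt (eulerQuot a b c d) (Q⁻¹ * (-(a * sigmaSum Q + 2 * b * sigmaSum (Q ^ 2) +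
      3 * c * sigmaSum (Q ^ 3) + 6 * d * sigmaSum (Q ^ 6)) * eulerQuot a b c d Q)) Q := by
  have key : ∀ k : ℕ, k ≠ 0 → ∀ e : ℤ, HasDerivAt (fun Q => eulerProd (Q ^ k) ^ e)
      (Q⁻¹ * (-(k * e * sigmaSum (Q ^ k)) * eulerProd (Q ^ k) ^ e)) Q := by
    intro k hk e
    have hE := eulerProd_pow_ne_zero hQ hk
    have := (hasDerivAt_zpow e (eulerProd (Q ^ k)) (Or.inl hE)).comp Q
      (hasDerivAt_eulerProd_pow hQ h0 hk)
    refine this.congr_deriv ?_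
    rw [zpow_sub₀ hE, zpow_one]
    field_simp
  have h1 := key 1 one_ne_zero a
  simp only [pow_one] at h1
  have := (((h1.mul (key 2 (by norm_num) b)).mul (key 3 (by norm_num) c)).mul
    (key 6 (by norm_num) d))
  refine this.congr_deriv ?_
  simp only [eulerQuot, Pi.mul_apply]
  push_cast
  ring

lemma differentiableAt_fSer (hQ : ‖Q‖ < 1) : DifferentiableAt ℂ fSer Q :=
  ((differentiableAt_lamNat hQ le_rfl (by norm_num)).const_mul 3).const_add 1

lemma differentiableAt_bSer (hQ : ‖Q‖ < 1) : DifferentiableAt ℂ bSer Q :=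
  ((differentiableAt_lamNat hQ (by norm_num) (by norm_num)).const_mul 6).const_add 1

@[simp] lemma fSer_zero : fSer 0 = 1 := by simp [fSer, lamNat_zero]

@[simp] lemma bSer_zero : bSer 0 = 1 := by simp [bSer, lamNat_zero]

lemma fSer_eq_eulerQuot (hQ : ‖Q‖ < 1) : fSer Q = eulerQuot (-3) 6 1 (-2) Q := by
  refine eq_of_same_logDeriv (fun _ => differentiableAt_fSer)
    (fun _ h => differentiableAt_eulerQuot h _ _ _ _) (fun _ h => eulerQuot_ne_zero h _ _ _ _)
    (R := fun Q => bSer Q * (fSer Q - bSer Q) - 6 * mSer Q)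
    (fun Q h h0 => (hasDerivAt_fSer h h0).congr_deriv (by ring)) (fun Q h h0 => ?_) (by simp) hQ
  refine (hasDerivAt_eulerQuot h h0 _ _ _ _).congr_deriv ?_
  obtain ⟨e1, e2, e3⟩ := fSer_bSer_quadratic h h0
  congr 2
  rw [mSer, lam_one_three h h0]
  push_cast
  linear_combination -e2 + e3

lemma fSer_ne_zero (hQ : ‖Q‖ < 1) : fSer Q ≠ 0 :=
  fSer_eq_eulerQuot hQ ▸ eulerQuot_ne_zero hQ _ _ _ _

lemma fSer_sub_bSer_eq_eulerQuot (hQ : ‖Q‖ < 1) :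
    (fSer Q - bSer Q) / 3 = Q * eulerQuot 1 (-2) (-3) 6 Q := by
  -- both sides have a simple zero at the cusp, which `dslope` divides out
  set g : ℂ → ℂ := fun Q => (fSer Q - bSer Q) / 3 with hg
  have hg0 : g 0 = 0 := by simp [hg]
  have hgd : ∀ Q : ℂ, ‖Q‖ < 1 → DifferentiableAt ℂ g Q := fun Q h =>
    ((differentiableAt_fSer h).sub (differentiableAt_bSer h)).div_const 3
  have hsl : ∀ Q : ℂ, Q ≠ 0 → dslope g 0 Q = Q⁻¹ * g Q := fun Q h => by
    rw [dslope_of_ne _ h, slope_def_field, hg0]; field_simp; ring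
  have hB : Metric.ball (0 : ℂ) 1 ∈ nhds (0 : ℂ) := Metric.ball_mem_nhds 0 one_pos
  have hds : ∀ Q : ℂ, ‖Q‖ < 1 → DifferentiableAt ℂ (dslope g 0) Q := fun Q h =>
    ((Complex.differentiableOn_dslope hB).2 fun w hw =>
      (hgd w (by simpa using hw)).differentiableWithinAt).differentiableAt
      (Metric.isOpen_ball.mem_nhds (by simpa using h))
  have hz : dslope g 0 0 = 1 := by
    have h1 := (hasDerivAt_lamNat_zero (s := 1) le_rfl (by norm_num)).const_mul 3 |>.const_add 1
    have h2 := (hasDerivAt_lamNat_zero (s := 2) (by norm_num) le_rfl).const_mul 6 |>.const_add 1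
    have h3 : HasDerivAt g _ 0 := (h1.sub h2).div_const 3
    rw [dslope_same, h3.deriv]
    norm_num
  have key := eq_of_same_logDeriv hds
    (fun _ h => differentiableAt_eulerQuot h 1 (-2) (-3) 6)
    (fun _ h => eulerQuot_ne_zero h _ _ _ _)
    (R := fun Q => 7 / 3 * fSer Q * bSer Q - 4 / 3 * fSer Q ^ 2 - 6 * mSer Q - 1)
    (fun Q h h0 => ?_) (fun Q h h0 => ?_) (by rw [hz, eulerQuot_zero]) hQ
  · rcases eq_or_ne Q 0 with rfl | h0
    · simp
    · rw [← key, hsl Q h0, mul_inv_cancel_left₀ h0]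
  · have h1 : HasDerivAt (fun Q => Q⁻¹ * g Q) _ Q := (hasDerivAt_inv h0).mul
      (((hasDerivAt_fSer h h0).sub (hasDerivAt_bSer h h0)).div_const 3)
    refine (h1.congr_of_eventuallyEq ?_).congr_deriv ?_
    · filter_upwards [eventually_ne_nhds h0] with w hw using hsl w hw
    · rw [hsl Q h0, hg]
      field_simp
      ring
  · refine (hasDerivAt_eulerQuot h h0 _ _ _ _).congr_deriv ?_
    obtain ⟨e1, e2, e3⟩ := fSer_bSer_quadratic h h0
    congr 2
    rw [mSer, lam_one_three h h0]
    push_cast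
    linear_combination (-7 / 3 : ℂ) * e2 + (4 / 3 : ℂ) * e1

/-- The logarithmic derivative of the modular function `u` is an eta quotient. -/
lemma weight_two_eq_eulerQuot (hQ : ‖Q‖ < 1) :
    (2 * fSer Q + bSer Q) * (3 * bSer Q - 2 * fSer Q) / 3 = eulerQuot 4 (-2) 4 (-2) Q := by
  refine eq_of_same_logDeriv (g := fun Q => (2 * fSer Q + bSer Q) * (3 * bSer Q - 2 * fSer Q) / 3)
    (fun _ h => ?_)
    (fun _ h => differentiableAt_eulerQuot h _ _ _ _) (fun _ h => eulerQuot_ne_zero h _ _ _ _)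
    (R := fun Q => 4 / 3 * fSer Q * (bSer Q - fSer Q) - 12 * mSer Q)
    (fun Q h h0 => ?_) (fun Q h h0 => ?_) (by norm_num) hQ
  · exact ((((differentiableAt_fSer h).const_mul 2).add (differentiableAt_bSer h)).mul
      (((differentiableAt_bSer h).const_mul 3).sub
        ((differentiableAt_fSer h).const_mul 2))).div_const 3
  · have hf := hasDerivAt_fSer h h0
    have hb := hasDerivAt_bSer h h0
    refine ((((hf.const_mul 2).add hb).mul ((hb.const_mul 3).sub
      (hf.const_mul 2))).div_const 3).congr_deriv ?_
    simp only [Pi.add_apply, Pi.sub_apply]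
    ring
  · refine (hasDerivAt_eulerQuot h h0 _ _ _ _).congr_deriv ?_
    obtain ⟨e1, e2, e3⟩ := fSer_bSer_quadratic h h0
    congr 2
    rw [mSer, lam_one_three h h0]
    push_cast
    linear_combination (4 / 3 : ℂ) * e1 - (4 / 3 : ℂ) * e2

/-! ### The hypergeometric series -/

/-- A power series with coefficients of at most linear growth may be differentiated termwise in
the unit disc. -/
lemma hasDerivAt_powerSeries {c : ℕ → ℂ} (hc : ∀ n, ‖c n‖ ≤ n + 1) {z : ℂ} (hz : ‖z‖ < 1) :
    (Summable fun n => (n + 1) * c n * z ^ n) ∧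
    HasDerivAt (fun z => ∑' n, c n * z ^ (n + 1)) (∑' n, (n + 1) * c n * z ^ n) z := by
  obtain ⟨r, hr, hr1⟩ := exists_between hz
  have hr0 : 0 < r := (norm_nonneg z).trans_lt hr
  have hs : Summable fun n : ℕ => ((n + 1 : ℕ) : ℝ) * r ^ (n + 1) := by
    have := summable_norm_pow_mul_geometric_of_norm_lt_one 1
      (show ‖r‖ < 1 by rwa [Real.norm_of_nonneg hr0.le])
    have hn : ∀ n : ℕ, |(n : ℝ) + 1| = n + 1 := fun n => abs_of_nonneg (by positivity)
    simpa [abs_of_pos hr0, hn] using! (summable_nat_add_iff 1).2 this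
  have hb : ∀ (n : ℕ) (w : ℂ), w ∈ Metric.ball (0 : ℂ) r →
      ‖c n * w ^ (n + 1)‖ ≤ ((n + 1 : ℕ) : ℝ) * r ^ (n + 1) := by
    intro n w hw
    have hw : ‖w‖ < r := by simpa using hw
    rw [norm_mul, norm_pow]
    push_cast
    gcongr
    exact hc n
  have hd : ∀ n : ℕ, DifferentiableOn ℂ (fun w => c n * w ^ (n + 1)) (Metric.ball (0 : ℂ) r) :=
    fun n => by fun_prop
  have hzU : z ∈ Metric.ball (0 : ℂ) r := by simpa using hr
  have hS := Complex.hasSum_deriv_of_summable_norm hs hd Metric.isOpen_ball hb hzU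
  have hS' : HasSum (fun n : ℕ => (n + 1) * c n * z ^ n)
      (deriv (fun z => ∑' n, c n * z ^ (n + 1)) z) := hS.congr_fun fun n => by
    rw [((hasDerivAt_pow (n + 1) z).const_mul (c n)).deriv, Nat.add_sub_cancel]
    push_cast; ring
  refine ⟨hS'.summable, ?_⟩
  rw [hS'.tsum_eq]
  exact ((Complex.differentiableOn_tsum_of_summable_norm hs hd Metric.isOpen_ball
    hb).differentiableAt (Metric.isOpen_ball.mem_nhds hzU)).hasDerivAt

/-- The coefficient `(4/3)_n (5/3)_n / (n! (n + 1)!)`. -/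
def hyperCoeff (n : ℕ) : ℂ :=
  pochhammerSymbol (4 / 3) n * pochhammerSymbol (5 / 3) n / ((n.factorial : ℂ) * (n + 1).factorial)

/-- The series `∑ (4/3)_n (5/3)_n / (n! (n + 1)!) w^(n + 1)`. -/
def hyperSum (w : ℂ) : ℂ := ∑' n, hyperCoeff n * w ^ (n + 1)

/-- The hypergeometric function `₂F₁(1/3, 2/3; 1; w)`, written through the coefficients
of its derivative. -/
def hyperF (w : ℂ) : ℂ := 1 + ∑' n : ℕ, 2 / 9 * hyperCoeff n / (n + 1) * w ^ (n + 1)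

lemma pochhammerSymbol_succ {a : ℂ} (n : ℕ) (ha : a + n ≠ 0) :
    pochhammerSymbol a (n + 1) = (a + n) * pochhammerSymbol a n := by
  rw [pochhammerSymbol, pochhammerSymbol, ← mul_div_assoc, ← Complex.Gamma_add_one _ ha]
  push_cast
  rw [add_assoc]

lemma hyperCoeff_zero : hyperCoeff 0 = 1 := by
  have h : ∀ a : ℂ, 0 < a.re → pochhammerSymbol a 0 = 1 := fun a ha => by
    rw [pochhammerSymbol, Nat.cast_zero, add_zero, div_self (Complex.Gamma_ne_zero_of_re_pos ha)]
  rw [hyperCoeff, h _ (by norm_num), h _ (by norm_num)]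
  simp

lemma hyperCoeff_succ (n : ℕ) : hyperCoeff (n + 1) =
    (n + 4 / 3) * (n + 5 / 3) / ((n + 1) * (n + 2)) * hyperCoeff n := by
  have h1 : (4 / 3 : ℂ) + n ≠ 0 := by
    have : ((4 + 3 * n : ℕ) : ℂ) ≠ 0 := by norm_cast; omega
    intro h; apply this; push_cast; linear_combination 3 * h
  have h2 : (5 / 3 : ℂ) + n ≠ 0 := by
    have : ((5 + 3 * n : ℕ) : ℂ) ≠ 0 := by norm_cast; omega
    intro h; apply this; push_cast; linear_combination 3 * h
  have h3 : (n : ℂ) + 1 ≠ 0 := by norm_cast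
  have h4 : (n : ℂ) + 2 ≠ 0 := by norm_cast
  have h5 : (n.factorial : ℂ) ≠ 0 := by exact_mod_cast n.factorial_ne_zero
  rw [hyperCoeff, hyperCoeff, pochhammerSymbol_succ n h1, pochhammerSymbol_succ n h2,
    Nat.factorial_succ (n + 1), Nat.factorial_succ n]
  push_cast
  rw [show (n : ℂ) + 1 + 1 = n + 2 by ring]
  field_simp
  ring

lemma norm_hyperCoeff_le (n : ℕ) : ‖hyperCoeff n‖ ≤ n + 1 := by
  induction n with
  | zero => simp [hyperCoeff_zero]
  | succ n ih =>
    have e : ‖((n : ℂ) + 4 / 3) * (n + 5 / 3) / ((n + 1) * (n + 2))‖ =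
        ((n : ℝ) + 4 / 3) * (n + 5 / 3) / ((n + 1) * (n + 2)) := by
      have : ((n : ℂ) + 4 / 3) * (n + 5 / 3) / ((n + 1) * (n + 2)) =
        ((((n : ℝ) + 4 / 3) * (n + 5 / 3) / ((n + 1) * (n + 2)) : ℝ) : ℂ) := by push_cast; ring
      rw [this, Complex.norm_real, Real.norm_of_nonneg (by positivity)]
    rw [hyperCoeff_succ, norm_mul, e]
    calc _ ≤ ((n : ℝ) + 4 / 3) * (n + 5 / 3) / ((n + 1) * (n + 2)) * (n + 1) := by gcongr
      _ ≤ _ := by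
        push_cast
        rw [div_mul_eq_mul_div, div_le_iff₀ (by positivity)]
        have : (0 : ℝ) ≤ n := n.cast_nonneg
        nlinarith [mul_nonneg this this, mul_nonneg (mul_nonneg this this) this]

lemma norm_hyperCoeff_div_le (n : ℕ) : ‖2 / 9 * hyperCoeff n / (n + 1)‖ ≤ n + 1 := by
  have h : ‖(n : ℂ) + 1‖ = n + 1 := by
    have : (n : ℂ) + 1 = ((n + 1 : ℕ) : ℂ) := by push_cast; rfl
    rw [this, Complex.norm_natCast]; push_cast; rfl
  rw [norm_div, norm_mul, h, div_le_iff₀ (by positivity)]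
  have h0 : (0 : ℝ) ≤ n := n.cast_nonneg
  have := norm_hyperCoeff_le n
  norm_num
  nlinarith [norm_nonneg (hyperCoeff n)]

lemma summable_hyperSum {w : ℂ} (hw : ‖w‖ < 1) :
    Summable fun n => hyperCoeff n * w ^ (n + 1) := by
  have h := summable_norm_pow_mul_geometric_of_norm_lt_one 1 hw
  have h' := (summable_nat_add_iff 1).2 h
  refine .of_norm_bounded h' fun n => ?_
  have e : ‖((n + 1 : ℕ) : ℂ)‖ = n + 1 := by rw [Complex.norm_natCast]; push_cast; rfl
  rw [norm_mul, norm_mul, norm_pow (_ : ℂ) 1, e, pow_one]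
  gcongr
  exact norm_hyperCoeff_le n

lemma hyperSum_zero : hyperSum 0 = 0 := by simp [hyperSum]

lemma hyperF_zero : hyperF 0 = 1 := by simp [hyperF]

/-- The derivative of `hyperF`, multiplied by the variable, is `hyperSum` up to a factor. -/
lemma hasDerivAt_hyperF {w : ℂ} (hw : ‖w‖ < 1) :
    ∃ F' : ℂ, HasDerivAt hyperF F' w ∧ w * F' = 2 / 9 * hyperSum w := by
  refine ⟨_, (hasDerivAt_powerSeries norm_hyperCoeff_div_le hw).2.const_add 1, ?_⟩
  rw [hyperSum, ← tsum_mul_left, ← tsum_mul_left]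
  refine tsum_congr fun n => ?_
  have h3 : (n : ℂ) + 1 ≠ 0 := by norm_cast
  field_simp
  ring

lemma differentiableAt_hyperSum {w : ℂ} (hw : ‖w‖ < 1) : DifferentiableAt ℂ hyperSum w :=
  (hasDerivAt_powerSeries norm_hyperCoeff_le hw).2.differentiableAt

/-- The hypergeometric differential equation of `₂F₁(1/3, 2/3; 1; w)` in self-adjoint form. -/
lemma hasDerivAt_one_sub_mul_hyperSum {w : ℂ} (hw : ‖w‖ < 1) :
    HasDerivAt (fun w => (1 - w) * hyperSum w) (hyperF w) w := by
  obtain ⟨hs, hd⟩ := hasDerivAt_powerSeries norm_hyperCoeff_le hw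
  have h : HasDerivAt (fun w => (1 - w) * hyperSum w) _ w :=
    ((hasDerivAt_id w).const_sub 1).mul hd
  refine h.congr_deriv ?_
  have h1 := hs.hasSum
  have h2 := (hasSum_nat_add_iff' 1).2 h1
  have h3 := h1.mul_left w
  have h4 := (summable_hyperSum hw).hasSum
  have key := ((h2.sub h3).sub h4).tsum_eq
  have e : hyperF w = 1 + ∑' n : ℕ, ((((n + 1 : ℕ) : ℂ) + 1) * hyperCoeff (n + 1) * w ^ (n + 1) -
      w * ((n + 1) * hyperCoeff n * w ^ n) - hyperCoeff n * w ^ (n + 1)) := by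
    rw [hyperF]
    congr 1
    refine tsum_congr fun n => ?_
    have h5 : (n : ℂ) + 1 ≠ 0 := by norm_cast
    have h6 : (n : ℂ) + 2 ≠ 0 := by norm_cast
    rw [hyperCoeff_succ]
    push_cast
    rw [show (n : ℂ) + 1 + 1 = n + 2 by ring]
    field_simp
    ring
  rw [e, key]
  simp [hyperCoeff_zero, hyperSum]
  ring

/-! ### The modular parametrization near the cusp -/

/-- The theta function of the hexagonal lattice, as a linear form in the two weight one forms. -/
def aSer (Q : ℂ) : ℂ := 2 * fSer Q - bSer Q

/-- The argument of the hypergeometric series as a function of `Q`. -/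
def argSer (Q : ℂ) : ℂ := (fSer Q - bSer Q) * (2 * fSer Q + bSer Q) ^ 2 / aSer Q ^ 3

lemma aSer_zero : aSer 0 = 1 := by norm_num [aSer]

lemma argSer_zero : argSer 0 = 0 := by simp [argSer]

lemma differentiableAt_aSer (hQ : ‖Q‖ < 1) : DifferentiableAt ℂ aSer Q :=
  ((differentiableAt_fSer hQ).const_mul 2).sub (differentiableAt_bSer hQ)

lemma differentiableAt_argSer (hQ : ‖Q‖ < 1) (ha : aSer Q ≠ 0) :
    DifferentiableAt ℂ argSer Q := by
  have hf := differentiableAt_fSer hQ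
  have hb := differentiableAt_bSer hQ
  exact ((hf.sub hb).mul (((hf.const_mul 2).add hb).pow 2)).div ((differentiableAt_aSer hQ).pow 3)
    (pow_ne_zero 3 ha)

lemma one_sub_argSer (ha : aSer Q ≠ 0) :
    1 - argSer Q = fSer Q * (3 * bSer Q - 2 * fSer Q) ^ 2 / aSer Q ^ 3 := by
  rw [argSer, eq_div_iff (pow_ne_zero 3 ha), sub_mul, div_mul_cancel₀ _ (pow_ne_zero 3 ha), aSer]
  ring

lemma hasDerivAt_aSer (hQ : ‖Q‖ < 1) (h0 : Q ≠ 0) :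
    HasDerivAt aSer (Q⁻¹ * (2 / 3 * fSer Q * (fSer Q - bSer Q) * (5 * bSer Q - 2 * fSer Q) -
      6 * aSer Q * mSer Q)) Q := by
  refine (((hasDerivAt_fSer hQ h0).const_mul 2).sub (hasDerivAt_bSer hQ h0)).congr_deriv ?_
  rw [aSer]
  ring

/-- The argument satisfies `Q dw/dQ = w (1 - w) a²`. -/
lemma hasDerivAt_argSer (hQ : ‖Q‖ < 1) (h0 : Q ≠ 0) (ha : aSer Q ≠ 0) :
    HasDerivAt argSer (Q⁻¹ * (argSer Q * (1 - argSer Q) * aSer Q ^ 2)) Q := by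
  have hf := hasDerivAt_fSer hQ h0
  have hb := hasDerivAt_bSer hQ h0
  refine (((hf.sub hb).mul (((hf.const_mul 2).add hb).pow 2)).div
    ((hasDerivAt_aSer hQ h0).pow 3) (pow_ne_zero 3 ha)).congr_deriv ?_
  rw [one_sub_argSer ha, argSer]
  simp only [Pi.mul_apply, Pi.pow_apply, Pi.add_apply, Pi.sub_apply]
  field_simp
  rw [aSer]
  ring

/-- The function `a` satisfies the hypergeometric equation in the variable `argSer`. -/
lemma hasDerivAt_aSer_deriv (hQ : ‖Q‖ < 1) (h0 : Q ≠ 0) (ha : aSer Q ≠ 0) :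
    HasDerivAt (fun Q => Q * deriv aSer Q / aSer Q ^ 2)
      (Q⁻¹ * (2 / 9 * argSer Q * (1 - argSer Q) * aSer Q ^ 3)) Q := by
  have hf := hasDerivAt_fSer hQ h0
  have hb := hasDerivAt_bSer hQ h0
  have hm := hasDerivAt_mSer hQ h0
  have hA := hasDerivAt_aSer hQ h0
  have h : HasDerivAt (fun Q => (2 / 3 * fSer Q * (fSer Q - bSer Q) * (5 * bSer Q - 2 * fSer Q) -
      6 * aSer Q * mSer Q) / aSer Q ^ 2) _ Q :=
    (((((hf.const_mul (2 / 3)).mul (hf.sub hb)).mul ((hb.const_mul 5).sub (hf.const_mul 2))).sub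
      ((hA.const_mul 6).mul hm)).div (hA.pow 2) (pow_ne_zero 2 ha))
  refine (h.congr_of_eventuallyEq ?_).congr_deriv ?_
  · filter_upwards [punctured_eventually hQ h0] with w hw
    rw [(hasDerivAt_aSer hw.1 hw.2).deriv, mul_inv_cancel_left₀ hw.2]
  · rw [one_sub_argSer ha, argSer]
    simp only [Pi.mul_apply, Pi.sub_apply]
    generalize mSer Q = m
    field_simp
    rw [aSer]
    ring

/-- Near the cusp `₂F₁(1/3, 2/3; 1; w) = a`. The statement is the derivative of this equality, with
`hyperSum` in place of the derivative of the hypergeometric function. -/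
lemma exists_radius_hyperSum : ∃ r : ℝ, 0 < r ∧ r ≤ 1 ∧ ∀ Q : ℂ, ‖Q‖ < r →
    aSer Q ≠ 0 ∧ ‖argSer Q‖ < 1 ∧
      2 / 9 * ((1 - argSer Q) * hyperSum (argSer Q)) = Q * deriv aSer Q / aSer Q ^ 2 := by
  have hz : ‖(0 : ℂ)‖ < 1 := by simp
  have h1 : ∀ᶠ Q in nhds (0 : ℂ), aSer Q ≠ 0 :=
    (differentiableAt_aSer hz).continuousAt.eventually_ne (by simp [aSer_zero])
  have h2 : ∀ᶠ Q in nhds (0 : ℂ), ‖argSer Q‖ < 1 :=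
    (differentiableAt_argSer hz (by simp [aSer_zero])).continuousAt.norm.eventually_lt_const
      (by simp [argSer_zero])
  obtain ⟨r', hr', hball⟩ := Metric.eventually_nhds_iff_ball.1 (h1.and h2)
  set r := min r' 1
  have hr : 0 < r := lt_min hr' one_pos
  have hmem : ∀ Q ∈ Metric.ball (0 : ℂ) r, ‖Q‖ < 1 ∧ aSer Q ≠ 0 ∧ ‖argSer Q‖ < 1 := fun Q hQ => by
    have hQ' : ‖Q‖ < r := by simpa using hQ
    exact ⟨hQ'.trans_le (min_le_right _ _),
      hball Q (by simpa using hQ'.trans_le (min_le_left _ _))⟩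
  set v : ℂ → ℂ := fun Q => Q * deriv aSer Q / aSer Q ^ 2 with hv
  set g : ℂ → ℂ := fun Q => 2 / 9 * ((1 - argSer Q) * hyperSum (argSer Q)) with hg
  set y : ℂ → ℂ := fun Q => hyperF (argSer Q) with hy
  have hdA : DifferentiableOn ℂ aSer (Metric.ball 0 r) := fun Q hQ =>
    (differentiableAt_aSer (hmem Q hQ).1).differentiableWithinAt
  have hdv : DifferentiableOn ℂ v (Metric.ball 0 r) :=
    (differentiableOn_id.mul (hdA.deriv Metric.isOpen_ball)).div (hdA.pow 2)
      fun Q hQ => pow_ne_zero 2 (hmem Q hQ).2.1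
  have hdz : ∀ Q ∈ Metric.ball (0 : ℂ) r, DifferentiableAt ℂ argSer Q := fun Q hQ =>
    differentiableAt_argSer (hmem Q hQ).1 (hmem Q hQ).2.1
  have hdg : DifferentiableOn ℂ g (Metric.ball 0 r) := fun Q hQ =>
    (((hasDerivAt_one_sub_mul_hyperSum (hmem Q hQ).2.2).differentiableAt.comp Q
      (hdz Q hQ)).const_mul (2 / 9)).differentiableWithinAt
  have hdy : DifferentiableOn ℂ y (Metric.ball 0 r) := fun Q hQ => by
    obtain ⟨F', hF, -⟩ := hasDerivAt_hyperF (hmem Q hQ).2.2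
    exact (hF.differentiableAt.comp Q (hdz Q hQ)).differentiableWithinAt
  have hy' : ∀ Q ∈ Metric.ball (0 : ℂ) r, Q ≠ 0 →
      HasDerivAt y (Q⁻¹ * (g Q * aSer Q ^ 2)) Q := fun Q hQ hQ0 => by
    obtain ⟨F', hF, hF'⟩ := hasDerivAt_hyperF (hmem Q hQ).2.2
    refine (hF.comp Q (hasDerivAt_argSer (hmem Q hQ).1 hQ0 (hmem Q hQ).2.1)).congr_deriv ?_
    simp only [hg]
    linear_combination (Q⁻¹ * (1 - argSer Q) * aSer Q ^ 2) * hF'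
  have hg' : ∀ Q ∈ Metric.ball (0 : ℂ) r, Q ≠ 0 →
      HasDerivAt g (Q⁻¹ * (2 / 9 * y Q * (argSer Q * (1 - argSer Q) * aSer Q ^ 2))) Q :=
    fun Q hQ hQ0 => by
      have := ((hasDerivAt_one_sub_mul_hyperSum (hmem Q hQ).2.2).comp Q
        (hasDerivAt_argSer (hmem Q hQ).1 hQ0 (hmem Q hQ).2.1)).const_mul (2 / 9)
      exact this.congr_deriv (by simp only [hy]; ring)
  have hA' : ∀ Q ∈ Metric.ball (0 : ℂ) r, Q ≠ 0 →
      HasDerivAt aSer (Q⁻¹ * (v Q * aSer Q ^ 2)) Q := fun Q hQ hQ0 => by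
    refine (differentiableAt_aSer (hmem Q hQ).1).hasDerivAt.congr_deriv ?_
    have := (hmem Q hQ).2.1
    simp only [hv]
    field_simp
  -- the Wronskian of the two solutions is constant, and vanishes at the cusp
  have hW : ∀ Q ∈ Metric.ball (0 : ℂ) r, aSer Q * g Q - y Q * v Q = 0 := fun Q hQ => by
    rw [eq_zero_value_of_deriv_eq_zero (g := fun Q => aSer Q * g Q - y Q * v Q)
      ((hdA.mul hdg).sub (hdy.mul hdv)) (fun Q hQ hQ0 => ?_) hQ]
    · simp [hg, hv, argSer_zero, hyperSum_zero]
    · rw [(((hA' Q hQ hQ0).fun_mul (hg' Q hQ hQ0)).fun_sub ((hy' Q hQ hQ0).fun_mul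
        (hasDerivAt_aSer_deriv (hmem Q hQ).1 hQ0 (hmem Q hQ).2.1))).deriv]
      simp only [hv]
      ring
  -- hence the quotient of the two solutions is constant, too
  have hya : ∀ Q ∈ Metric.ball (0 : ℂ) r, y Q = aSer Q := fun Q hQ => by
    have := eq_zero_value_of_deriv_eq_zero (g := fun Q => y Q / aSer Q)
      (hdy.div hdA fun Q hQ => (hmem Q hQ).2.1) (fun Q hQ hQ0 => ?_) hQ
    · simp only [hy, argSer_zero, hyperF_zero, aSer_zero, div_one] at this
      exact (div_eq_one_iff_eq (hmem Q hQ).2.1).1 this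
    · rw [((hy' Q hQ hQ0).fun_div (hA' Q hQ hQ0) (hmem Q hQ).2.1).deriv, div_eq_zero_iff]
      left
      linear_combination (Q⁻¹ * aSer Q ^ 2) * hW Q hQ
  refine ⟨r, hr, min_le_right _ _, fun Q hQ => ?_⟩
  have hQ' : Q ∈ Metric.ball (0 : ℂ) r := by simpa using hQ
  have hw := hW Q hQ'
  rw [hya Q hQ', ← mul_sub, mul_eq_zero] at hw
  exact ⟨(hmem Q hQ').2.1, (hmem Q hQ').2.2,
    sub_eq_zero.1 (hw.resolve_left (hmem Q hQ').2.1)⟩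

/-! ### Eta quotients as functions of `z` -/

open Function.Periodic

/-- The nome `q = exp (2 π i z)`. -/
abbrev nome (z : ℂ) : ℂ := qParam 1 z

lemma norm_nome_lt_one {z : ℂ} (hz : 0 < z.im) : ‖nome z‖ < 1 := by
  rw [nome, norm_qParam, Real.exp_lt_one_iff]
  have := Real.pi_pos
  rw [div_one]
  nlinarith [mul_pos this hz]

lemma nome_ne_zero (z : ℂ) : nome z ≠ 0 := qParam_ne_zero z

lemma nome_natCast_mul (n : ℕ) (z : ℂ) : nome (n * z) = nome z ^ n := by
  simp only [nome, qParam, ← Complex.exp_nat_mul]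
  congr 1
  push_cast
  ring

lemma hasDerivAt_nome (z : ℂ) :
    HasDerivAt nome (2 * Real.pi * Complex.I * nome z) z := by
  have h : HasDerivAt (fun z : ℂ => Complex.exp (2 * Real.pi * Complex.I * z / (1 : ℝ))) _ z :=
    (((hasDerivAt_id z).const_mul (2 * Real.pi * Complex.I)).div_const _).cexp
  refine h.congr_deriv ?_
  simp [nome, qParam]
  ring

/-- The eta function is a power of `exp (2 π i z / 24)` times an Euler product. -/
lemma etaN_eq (n : ℕ) (z : ℂ) : etaN n z = qParam 24 z ^ n * eulerProd (nome z ^ n) := by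
  have h : qParam 24 (n * z) = qParam 24 z ^ n := by
    simp only [qParam, ← Complex.exp_nat_mul]
    congr 1
    push_cast
    ring
  rw [etaN, ModularForm.eta, h, eulerProd]
  congr 1
  refine tprod_congr fun k => ?_
  change 1 - nome (n * z) ^ (k + 1) = _
  rw [nome_natCast_mul]

lemma qParam_pow_twentyFour (z : ℂ) : qParam 24 z ^ 24 = nome z := by
  simp only [nome, qParam, ← Complex.exp_nat_mul]
  congr 1
  push_cast
  ring

variable {z : ℂ}

lemma etaN_ne_zero (hz : 0 < z.im) {n : ℕ} (hn : n ≠ 0) : etaN n z ≠ 0 := by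
  rw [etaN_eq]
  exact mul_ne_zero (pow_ne_zero _ (qParam_ne_zero z))
    (eulerProd_pow_ne_zero (norm_nome_lt_one hz) hn)

lemma differentiableAt_etaN (hz : 0 < z.im) {n : ℕ} (hn : n ≠ 0) :
    DifferentiableAt ℂ (etaN n) z := by
  have h : DifferentiableAt ℂ ModularForm.eta (n * z) :=
    ModularForm.differentiableAt_eta_of_mem_upperHalfPlaneSet (by
      change 0 < ((n : ℂ) * z).im
      have : 0 < (n : ℝ) := by positivity
      simpa using mul_pos this hz)
  exact h.comp z (by fun_prop)

lemma f₂_eq_fSer (hz : 0 < z.im) : f₂ z = fSer (nome z) := by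
  have hq := norm_nome_lt_one hz
  have ht := qParam_ne_zero (h := 24) z
  have h1 := eulerProd_ne_zero hq
  have h2 := eulerProd_pow_ne_zero hq (d := 2) (by norm_num)
  have h3 := eulerProd_pow_ne_zero hq (d := 3) (by norm_num)
  have h6 := eulerProd_pow_ne_zero hq (d := 6) (by norm_num)
  rw [fSer_eq_eulerQuot hq, f₂, etaN_eq, etaN_eq, etaN_eq, etaN_eq, eulerQuot, pow_one, pow_one]
  generalize qParam 24 z = t at *
  simp only [zpow_neg, zpow_ofNat]
  field_simp

/-- In terms of `u = (fSer - bSer) / (3 fSer)` this reads `x² = 9 u`. -/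
lemma xPar_sq_eq (hz : 0 < z.im) :
    xPar z ^ 2 = 3 * (fSer (nome z) - bSer (nome z)) / fSer (nome z) := by
  have hq := norm_nome_lt_one hz
  have ht := qParam_ne_zero (h := 24) z
  have h1 := eulerProd_ne_zero hq
  have h2 := eulerProd_pow_ne_zero hq (d := 2) (by norm_num)
  have h3 := eulerProd_pow_ne_zero hq (d := 3) (by norm_num)
  have h6 := eulerProd_pow_ne_zero hq (d := 6) (by norm_num)
  have e := fSer_sub_bSer_eq_eulerQuot hq
  rw [div_eq_iff (by norm_num)] at e
  rw [e, fSer_eq_eulerQuot hq, xPar, etaN_eq, etaN_eq, etaN_eq, etaN_eq, eulerQuot, eulerQuot,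
    pow_one, pow_one]
  have h24 := qParam_pow_twentyFour z
  set q := nome z
  generalize qParam 24 z = t at *
  simp only [zpow_neg, zpow_ofNat]
  field_simp
  rw [← h24]

/-- The first coefficient function on the right-hand side, multiplied by `f₂`. -/
lemma coeff_f₂_eq (hz : 0 < z.im) :
    etaN 1 z ^ 14 * etaN 6 z ^ 10 / (etaN 2 z ^ 22 * etaN 3 z ^ 2) * fSer (nome z) ^ 2 =
      (fSer (nome z) - bSer (nome z)) / 3 / fSer (nome z) *
      ((2 * fSer (nome z) + bSer (nome z)) * (3 * bSer (nome z) - 2 * fSer (nome z)) / 3) := by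
  have hq := norm_nome_lt_one hz
  have ht := qParam_ne_zero (h := 24) z
  have h1 := eulerProd_ne_zero hq
  have h2 := eulerProd_pow_ne_zero hq (d := 2) (by norm_num)
  have h3 := eulerProd_pow_ne_zero hq (d := 3) (by norm_num)
  have h6 := eulerProd_pow_ne_zero hq (d := 6) (by norm_num)
  rw [fSer_sub_bSer_eq_eulerQuot hq, weight_two_eq_eulerQuot hq, fSer_eq_eulerQuot hq, etaN_eq,
    etaN_eq, etaN_eq, etaN_eq, eulerQuot, eulerQuot, eulerQuot, pow_one, pow_one]
  have h24 := qParam_pow_twentyFour z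
  set q := nome z
  generalize qParam 24 z = t at *
  simp only [zpow_neg, zpow_ofNat]
  field_simp
  rw [← h24]

lemma coeff_qDeriv_eq (hz : 0 < z.im) :
    etaN 1 z ^ 6 * etaN 6 z ^ 4 / (etaN 2 z ^ 12 * etaN 3 z ^ 2) * f₂ z ^ 2 = 1 := by
  have h1 := etaN_ne_zero hz (n := 1) (by norm_num)
  have h2 := etaN_ne_zero hz (n := 2) (by norm_num)
  have h3 := etaN_ne_zero hz (n := 3) (by norm_num)
  have h6 := etaN_ne_zero hz (n := 6) (by norm_num)
  rw [f₂]
  field_simp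

/-! ### The identity near the cusp and its continuation -/

lemma xPar_sq_add_three (hz : 0 < z.im) :
    xPar z ^ 2 + 3 = 3 * aSer (nome z) / fSer (nome z) := by
  have hf := fSer_ne_zero (norm_nome_lt_one hz)
  rw [xPar_sq_eq hz, aSer]
  field_simp
  ring

lemma hyperArg_xPar (hz : 0 < z.im) (ha : aSer (nome z) ≠ 0) :
    hyperArg (xPar z) = argSer (nome z) := by
  have hf := fSer_ne_zero (norm_nome_lt_one hz)
  rw [hyperArg, xPar_sq_add_three hz, xPar_sq_eq hz, argSer]
  field_simp
  ring

lemma H_eq (x : ℂ) :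
    H x = (x ^ 2 - 1) ^ 2 / (9 * (x ^ 2 + 3)) * hyperSum (hyperArg x) := rfl

lemma f₂_eventuallyEq (hz : 0 < z.im) : f₂ =ᶠ[nhds z] fun w => fSer (nome w) := by
  filter_upwards [Complex.continuous_im.continuousAt.eventually_const_lt hz] with w hw
    using f₂_eq_fSer hw

lemma hasDerivAt_f₂ (hz : 0 < z.im) :
    HasDerivAt f₂ (2 * Real.pi * Complex.I * (nome z * deriv fSer (nome z))) z := by
  have h := (differentiableAt_fSer (norm_nome_lt_one hz)).hasDerivAt.comp z (hasDerivAt_nome z)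
  exact (h.congr_of_eventuallyEq (f₂_eventuallyEq hz)).congr_deriv (by ring)

lemma qDeriv_f₂ (hz : 0 < z.im) : qDeriv f₂ z = nome z * deriv fSer (nome z) := by
  rw [qDeriv, (hasDerivAt_f₂ hz).deriv, inv_mul_cancel_left₀]
  simp [Real.pi_ne_zero]

/-- The right-hand side of the identity. -/
def etaSide (z : ℂ) : ℂ :=
  1 / 2 *
    (etaN 1 z ^ 14 * etaN 6 z ^ 10 / (etaN 2 z ^ 22 * etaN 3 z ^ 2) * f₂ z +
      etaN 1 z ^ 6 * etaN 6 z ^ 4 / (etaN 2 z ^ 12 * etaN 3 z ^ 2) *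
        (etaN 1 z ^ 4 * etaN 6 z ^ 8 / (etaN 2 z ^ 8 * etaN 3 z ^ 4) + 1 / 3) * qDeriv f₂ z)

lemma H_xPar_eq_etaSide_of_small {r : ℝ} (hr : ∀ Q : ℂ, ‖Q‖ < r → aSer Q ≠ 0 ∧ ‖argSer Q‖ < 1 ∧
      2 / 9 * ((1 - argSer Q) * hyperSum (argSer Q)) = Q * deriv aSer Q / aSer Q ^ 2)
    (hz : 0 < z.im) (hzr : ‖nome z‖ < r) : H (xPar z) = etaSide z := by
  have hq := norm_nome_lt_one hz
  have hq0 := nome_ne_zero z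
  have hf := fSer_ne_zero hq
  obtain ⟨ha, hn, key⟩ := hr _ hzr
  have hA : 1 - argSer (nome z) ≠ 0 := by
    intro h
    rw [← sub_eq_zero.1 h] at hn
    simp at hn
  have c1 := coeff_f₂_eq hz
  have c2 := coeff_qDeriv_eq hz
  rw [f₂_eq_fSer hz] at c2
  have c3 : etaN 1 z ^ 4 * etaN 6 z ^ 8 / (etaN 2 z ^ 8 * etaN 3 z ^ 4) = xPar z ^ 2 / 9 := by
    rw [xPar]; ring
  rw [← eq_div_iff (pow_ne_zero 2 hf)] at c1 c2
  rw [etaSide, c1, c2, c3, qDeriv_f₂ hz, f₂_eq_fSer hz, H_eq, hyperArg_xPar hz ha,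
    xPar_sq_add_three hz, xPar_sq_eq hz]
  rw [(hasDerivAt_aSer hq hq0).deriv, mul_inv_cancel_left₀ hq0] at key
  rw [(hasDerivAt_fSer hq hq0).deriv, mul_inv_cancel_left₀ hq0]
  rw [one_sub_argSer ha] at key hA
  have h32 : 3 * bSer (nome z) - 2 * fSer (nome z) ≠ 0 := by
    intro h; apply hA; rw [h]; simp
  have hS : hyperSum (argSer (nome z)) = 9 / 2 * aSer (nome z) *
      (2 / 3 * fSer (nome z) * (fSer (nome z) - bSer (nome z)) *
        (5 * bSer (nome z) - 2 * fSer (nome z)) - 6 * aSer (nome z) * mSer (nome z)) /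
      (fSer (nome z) * (3 * bSer (nome z) - 2 * fSer (nome z)) ^ 2) := by
    rw [eq_div_iff (mul_ne_zero hf (pow_ne_zero 2 h32))]
    field_simp at key
    linear_combination key / 6
  have e : 3 * (fSer (nome z) - bSer (nome z)) / fSer (nome z) - 1 =
      -(3 * bSer (nome z) - 2 * fSer (nome z)) / fSer (nome z) := by
    field_simp
    ring
  rw [hS, e]
  generalize mSer (nome z) = m
  field_simp
  rw [aSer]
  ring

lemma differentiableAt_xPar (hz : 0 < z.im) : DifferentiableAt ℂ xPar z := by
  have h1 := differentiableAt_etaN hz (n := 1) (by norm_num)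
  have h2 := differentiableAt_etaN hz (n := 2) (by norm_num)
  have h3 := differentiableAt_etaN hz (n := 3) (by norm_num)
  have h6 := differentiableAt_etaN hz (n := 6) (by norm_num)
  have n2 := etaN_ne_zero hz (n := 2) (by norm_num)
  have n3 := etaN_ne_zero hz (n := 3) (by norm_num)
  exact (((h1.pow 2).mul (h6.pow 4)).div ((h2.pow 4).mul (h3.pow 2))
    (mul_ne_zero (pow_ne_zero _ n2) (pow_ne_zero _ n3))).const_mul 3

lemma isOpen_halfPlane (C : ℝ) : IsOpen {z : ℂ | C < z.im} :=
  isOpen_lt continuous_const Complex.continuous_im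

lemma differentiableAt_qDeriv_f₂ (hz : 0 < z.im) : DifferentiableAt ℂ (qDeriv f₂) z := by
  have hd : DifferentiableOn ℂ f₂ {z : ℂ | 0 < z.im} := fun w hw =>
    (hasDerivAt_f₂ hw).differentiableAt.differentiableWithinAt
  exact ((hd.deriv (isOpen_halfPlane 0)).differentiableAt
    ((isOpen_halfPlane 0).mem_nhds hz)).const_mul _

lemma differentiableAt_etaSide (hz : 0 < z.im) : DifferentiableAt ℂ etaSide z := by
  have h1 := differentiableAt_etaN hz (n := 1) (by norm_num)
  have h2 := differentiableAt_etaN hz (n := 2) (by norm_num)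
  have h3 := differentiableAt_etaN hz (n := 3) (by norm_num)
  have h6 := differentiableAt_etaN hz (n := 6) (by norm_num)
  have n2 := etaN_ne_zero hz (n := 2) (by norm_num)
  have n3 := etaN_ne_zero hz (n := 3) (by norm_num)
  have hn : ∀ i j : ℕ, etaN 2 z ^ i * etaN 3 z ^ j ≠ 0 := fun i j =>
    mul_ne_zero (pow_ne_zero _ n2) (pow_ne_zero _ n3)
  have hq : ∀ a b i j : ℕ, DifferentiableAt ℂ
      (fun z => etaN 1 z ^ a * etaN 6 z ^ b / (etaN 2 z ^ i * etaN 3 z ^ j)) z := fun a b i j =>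
    ((h1.pow a).mul (h6.pow b)).div ((h2.pow i).mul (h3.pow j)) (hn i j)
  exact (((hq 14 10 22 2).mul (hasDerivAt_f₂ hz).differentiableAt).add
    (((hq 6 4 12 2).mul ((hq 4 8 8 4).add_const (1 / 3))).mul
      (differentiableAt_qDeriv_f₂ hz))).const_mul (1 / 2)

lemma differentiableAt_hyperArg_xPar (hz : 0 < z.im) (h3 : xPar z ^ 2 + 3 ≠ 0) :
    DifferentiableAt ℂ (fun z => hyperArg (xPar z)) z := by
  have hx := differentiableAt_xPar hz
  exact ((hx.pow 2).mul (((hx.pow 2).sub_const 9).pow 2)).div (((hx.pow 2).add_const 3).pow 3)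
    (pow_ne_zero 3 h3)

lemma differentiableAt_H_xPar (hz : z ∈ convergenceRegion) :
    DifferentiableAt ℂ (fun z => H (xPar z)) z := by
  obtain ⟨hz, h3, h⟩ := hz
  have hx := differentiableAt_xPar hz
  exact ((((hx.pow 2).sub_const 1).pow 2).div (((hx.pow 2).add_const 3).const_mul 9)
    (mul_ne_zero (by norm_num) h3)).mul
    (DifferentiableAt.comp z (differentiableAt_hyperSum h) (differentiableAt_hyperArg_xPar hz h3))

lemma isOpen_convergenceRegion : IsOpen convergenceRegion := by
  refine isOpen_iff_mem_nhds.2 fun z hz => ?_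
  obtain ⟨hz, h3, h⟩ := hz
  have hx := (differentiableAt_xPar hz).continuousAt
  filter_upwards [(isOpen_halfPlane 0).mem_nhds hz,
    ((hx.pow 2).add_const 3).eventually_ne h3,
    (differentiableAt_hyperArg_xPar hz h3).continuousAt.norm.eventually_lt_const h] with w h1 h2 h4
  exact ⟨h1, h2, h4⟩

/-- On a half-plane around the cusp, the nome is as small as desired. -/
lemma exists_norm_nome_lt {r : ℝ} (hr : 0 < r) :
    ∃ C : ℝ, 0 ≤ C ∧ ∀ z : ℂ, C < z.im → ‖nome z‖ < r := by
  refine ⟨max 0 (-Real.log r / (2 * Real.pi)), le_max_left _ _, fun z hz => ?_⟩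
  have h := (le_max_right 0 _).trans_lt hz
  rw [div_lt_iff₀ (by positivity)] at h
  rw [nome, norm_qParam, div_one, ← Real.lt_log_iff_exp_lt hr]
  linarith

/-- On a half-plane around the cusp the series converges and the identity holds. -/
lemma exists_halfPlane : ∃ C : ℝ, {z : ℂ | C < z.im} ⊆ convergenceRegion ∧
    ∀ z : ℂ, C < z.im → H (xPar z) = etaSide z := by
  obtain ⟨r, hr0, hr1, hr⟩ := exists_radius_hyperSum
  obtain ⟨C, hC0, hC⟩ := exists_norm_nome_lt hr0
  refine ⟨C, fun z hz => ?_, fun z hz =>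
    H_xPar_eq_etaSide_of_small hr (hC0.trans_lt hz) (hC z hz)⟩
  have hz0 : 0 < z.im := hC0.trans_lt hz
  obtain ⟨ha, hn, -⟩ := hr _ (hC z hz)
  refine ⟨hz0, ?_, by rwa [hyperArg_xPar hz0 ha]⟩
  rw [xPar_sq_add_three hz0]
  exact div_ne_zero (mul_ne_zero three_ne_zero ha) (fSer_ne_zero (norm_nome_lt_one hz0))

lemma exists_halfPlane_subset_cuspComponent : ∃ C : ℝ, {z : ℂ | C < z.im} ⊆ cuspComponent := by
  obtain ⟨C, hC, -⟩ := exists_halfPlane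
  exact ⟨C, fun z hz => ⟨{z : ℂ | C < z.im}, hC, (convex_halfSpace_im_gt C).isPreconnected,
    hz, C, subset_rfl⟩⟩

/-- Analytic continuation of the identity along the connected component of the cusp. -/
lemma H_xPar_eq_etaSide (hz : z ∈ cuspComponent) : H (xPar z) = etaSide z := by
  obtain ⟨S, hS, hconn, hzS, C, hC⟩ := hz
  obtain ⟨C', -, hC'⟩ := exists_halfPlane
  have hH : AnalyticOnNhd ℂ (fun z => H (xPar z)) convergenceRegion :=
    DifferentiableOn.analyticOnNhd (fun w hw =>
      (differentiableAt_H_xPar hw).differentiableWithinAt) isOpen_convergenceRegion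
  have hE : AnalyticOnNhd ℂ etaSide convergenceRegion :=
    DifferentiableOn.analyticOnNhd (fun w hw =>
      (differentiableAt_etaSide hw.1).differentiableWithinAt) isOpen_convergenceRegion
  have h0 : max C C' < (((max C C' + 1 : ℝ) : ℂ) * Complex.I).im := by simp
  refine (hH.mono hS).eqOn_of_preconnected_of_eventuallyEq (hE.mono hS) hconn
    (hC ((le_max_left C C').trans_lt h0)) ?_ hzS
  filter_upwards [(isOpen_halfPlane (max C C')).mem_nhds h0] with w hw
  exact hC' w ((le_max_right C C').trans_lt hw)

end EtaSunrise

end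

theorem mainTheorem4 :
    (∃ C : ℝ, {z : ℂ | C < z.im} ⊆ EtaSunrise.cuspComponent) ∧
    ∀ z ∈ EtaSunrise.cuspComponent,
      Summable (EtaSunrise.hyperTerm (EtaSunrise.xPar z)) ∧
      DifferentiableAt ℂ EtaSunrise.f₂ z ∧
      EtaSunrise.H (EtaSunrise.xPar z) =
        1 / 2 *
          (EtaSunrise.etaN 1 z ^ 14 * EtaSunrise.etaN 6 z ^ 10 /
              (EtaSunrise.etaN 2 z ^ 22 * EtaSunrise.etaN 3 z ^ 2) * EtaSunrise.f₂ z +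
            EtaSunrise.etaN 1 z ^ 6 * EtaSunrise.etaN 6 z ^ 4 /
              (EtaSunrise.etaN 2 z ^ 12 * EtaSunrise.etaN 3 z ^ 2) *
              (EtaSunrise.etaN 1 z ^ 4 * EtaSunrise.etaN 6 z ^ 8 /
                  (EtaSunrise.etaN 2 z ^ 8 * EtaSunrise.etaN 3 z ^ 4) + 1 / 3) *
              EtaSunrise.qDeriv EtaSunrise.f₂ z) := by
  refine ⟨EtaSunrise.exists_halfPlane_subset_cuspComponent, fun z hz => ?_⟩
  have hR : z ∈ EtaSunrise.convergenceRegion := by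
    obtain ⟨S, hS, -, hzS, -⟩ := hz
    exact hS hzS
  exact ⟨EtaSunrise.summable_hyperSum hR.2.2, (EtaSunrise.hasDerivAt_f₂ hR.1).differentiableAt,
    EtaSunrise.H_xPar_eq_etaSide hz⟩
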